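/- **Maps.** A rooted planar map is a connected planar map with a distinguished oriented edge (the root edge), taken up to orientation-preserving homeomorphism fixing the root edge (combinatorially: darts with an involution and a face permutation, connected, satisfying Euler's formula, up to relabelling of the darts). The root vertex is the origin of the root edge and the infinite face is the face on the right of the root edge; the other faces are finite. For a finite face $f$ of $m$, let $\Phi(m,f)$ be the map obtained by drawing a new vertex in $f$ and joining it to the corners of $f$. Let $\triangle_2$ consist of the rooted triangle $\Theta$ and, for $k\ge 1$, let $\triangle_{2(k+1)}$ be the set of all $\Phi(m,f)$, $m\in\triangle_{2k}$, $f$ a finite face of $m$; the elements of $\triangle_{2k}$ are the stack-triangulations with $2k$ faces. A vertex is internal if it is not incident to the infinite face. $d_m$ is the graph distance and $\deg_m$ the vertex degree. A history of $m\in\triangle_{2k}$ is a sequence $((m_i,f_i))_{1\le i\le k-1}$ with $m_i\in\triangle_{2i}$, $f_i$ a finite face of $m_i$, $m_{i+1}=\Phi(m_i,f_i)$, $m_k=m$ (pairs $(m_i,f_i)$ being taken up to isomorphism). $H_\triangle(k)$ is the set of all histories of elements of $\triangle_{2k}$. **Trees.** A planar tree is a set $t$ of finite words on $\{1,2,\dots\}$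 that contains the empty word and such that, if $ui\in t$ with $i$ a letter, then $u\in t$ and $uj\in t$ for $1\le j\le i$. A node without child is a leaf ($\partial t$ is the set of leaves), the others are internal nodes ($t^\circ$). $\mathcal T^{\rm ter}_n$ is the set of planar trees with $n$ nodes in which every node has $0$ or $3$ children. For $u\in\partial t$ let $\phi(t,u)=t\cup\{u1,u2,u3\}$. A history of $t\in\mathcal T^{\rm ter}_{3k-2}$ is a sequence $((t_i,u_i))_{1\le i\le k-1}$ with $t_1=\{\varnothing\}$, $u_i\in\partial t_i$, $t_{i+1}=\phi(t_i,u_i)$, $t_k=t$. $H_{\mathcal T}(k)$ is the set of all histories of elements of $\mathcal T^{\rm ter}_{3k-2}$. **Passage function.** For a word $u=u_1\cdots u_n$ on $\{1,2,3\}$ put $\tau_1(u)=0$, $\tau_2(u)=\inf\{i>0: u_i=1\}$ and, for $j\ge 3$, $\tau_j(u)=\inf\{i>\tau_{j-1}(u): u_{1+\tau_{j-1}(u)}\cdots u_i \text{ contains each of } 1,2,3\}$ (with $\inf\emptyset=\infty$), and $\Gamma(u)=\max\{i:\tau_i(u)\le |u|\}$. For two words $u=wa$, $v=wb$, where $w$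 is their longest common prefix, $\Gamma(u,v)=\Gamma(a)+\Gamma(b)$. **Statement.** There are maps $\Psi_K$, $\psi_K$ ($K\ge1$) such that for every $K\ge 1$, $\Psi_K$ is a bijection from $\triangle_{2K}$ onto $\mathcal T^{\rm ter}_{3K-2}$ and the following holds. Let $m\in\triangle_{2K}$ and $t=\Psi_K(m)$. Then all faces of $m$ are triangles, their number is $2K$, and: 1. (a) there is a bijection $u\mapsto u'$ from the internal vertices of $m$ onto $t^\circ$; (b) there is a bijection $f\mapsto\ell_m(f)$ from the finite faces of $m$ onto $\partial t$; 2. for every internal vertex $u$ of $m$, $d_m(\text{root vertex},u)=\Gamma(u')$; for all internal vertices $u,v$ of $m$, $|d_m(u,v)-\Gamma(u',v')|\le 4$; 3. for every internal vertex $u$ of $m$, $$\deg_m(u)=3+\#\{v'\in t^\circ : v'=u'w',\ w'\in 1\{2,3\}^\star\cup 2\{1,3\}^\star\cup 3\{1,2\}^\star\},$$ where $\{a,b\}^\star$ is the set of all finite words, including the empty one, on the letters $a,b$. Moreover, $\psi_K$ is a bijection from $H_\triangle(K)$ onto $H_{\mathcal T}(K)$ that sends every history $((m_i,f_i))_i$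 of $m$ to the history $((\Psi_i(m_i),\ell_{m_i}(f_i)))_i$ of $\Psi_K(m)$. It is consistent: for $1\le j\le K$, $\psi_j$ sends the first $j-1$ terms of $h\in H_\triangle(K)$ to the first $j-1$ terms of $\psi_K(h)$. It is robust: $h_1,h_2\in H_\triangle(K)$ are histories of the same map if and only if $\psi_K(h_1),\psi_K(h_2)$ are histories of the same tree. -/

import Mathlib

/-! ## Rooted planar maps

A map on an oriented surface is described by its darts (oriented edges), the involution `inv`
reversing a dart, and the permutation `next` sending a dart `d` to the dart that follows `d` on the
boundary of the face lying to the left of `d`.  Faces are the cycles of `next`; vertices are the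
cycles of `rot = inv ∘ next⁻¹`, the counterclockwise rotation around the origin of a dart.  The map
is planar when it is connected and satisfies Euler's formula.  Two rooted maps are identified when
they differ by a relabelling of the darts, which is the same as an orientation preserving
homeomorphism of the sphere fixing the root. -/

/-- Faces of the combinatorial map with face permutation `next`: the cycles of `next`. -/
abbrev FaceOrbit {D : Type} (next : Equiv.Perm D) : Type :=
  Quotient (Equiv.Perm.SameCycle.setoid next)

/-- Vertices of a combinatorial map: the cycles of the rotation `inv ∘ next⁻¹`. -/
abbrev VertexOrbit {D : Type} (inv next : Equiv.Perm D) : Type :=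
  Quotient (Equiv.Perm.SameCycle.setoid (inv * next⁻¹))

/-- Rooted planar maps. -/
structure RootedMap where
  /-- oriented edges -/
  Dart : Type
  finite_dart : Finite Dart
  /-- reversal of a dart -/
  inv : Equiv.Perm Dart
  /-- the next dart around the face on the left of a dart -/
  next : Equiv.Perm Dart
  /-- the root edge; the infinite face lies on its right -/
  root : Dart
  inv_inv : ∀ d, inv (inv d) = d
  inv_ne : ∀ d, inv d ≠ d
  connected : ∀ d d' : Dart, Relation.EqvGen (fun a b => b = inv a ∨ b = next a) d d'
  /-- Euler's formula `V + F = E + 2`, where `2 E` is the number of darts -/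
  euler : 2 * (Nat.card (VertexOrbit inv next) + Nat.card (FaceOrbit next)) = Nat.card Dart + 4

namespace RootedMap

variable (m : RootedMap)

/-- The vertices of a map. -/
abbrev Vertex : Type := VertexOrbit m.inv m.next

/-- The faces of a map. -/
abbrev Face : Type := FaceOrbit m.next

/-- The vertex from which a dart starts. -/
def origin (d : m.Dart) : m.Vertex := Quotient.mk _ d

/-- The face on the left of a dart. -/
def faceOf (d : m.Dart) : m.Face := Quotient.mk _ d

/-- The root vertex. -/
def rootVertex : m.Vertex := m.origin m.root

/-- The infinite face is the face on the right of the root. -/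
def outerFace : m.Face := m.faceOf (m.inv m.root)

/-- The finite faces. -/
def finiteFaces : Set m.Face := {f | f ≠ m.outerFace}

/-- The degree of a face: its number of sides. -/
noncomputable def faceDegree (f : m.Face) : ℕ := Nat.card {d : m.Dart // m.faceOf d = f}

/-- The internal vertices: those that are not incident to the infinite face. -/
def internalVertices : Set m.Vertex := {v | ∀ d, m.origin d = v → m.faceOf d ≠ m.outerFace}

/-- The degree of a vertex. -/
noncomputable def degree (v : m.Vertex) : ℕ := Nat.card {d : m.Dart // m.origin d = v}

/-- The graph carried by a map. -/
def graph : SimpleGraph m.Vertex where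
  Adj v w := v ≠ w ∧ ∃ d, m.origin d = v ∧ m.origin (m.inv d) = w
  symm := ⟨by
    rintro v w ⟨hne, d, h1, h2⟩
    exact ⟨hne.symm, m.inv d, h2, by rw [m.inv_inv]; exact h1⟩⟩
  loopless := ⟨fun _ h => h.1 rfl⟩

/-- The graph distance in a map. -/
noncomputable def dist (v w : m.Vertex) : ℕ := m.graph.dist v w

variable {m} in
theorem faceOf_next (d : m.Dart) : m.faceOf (m.next d) = m.faceOf d :=
  Quotient.sound (s := Equiv.Perm.SameCycle.setoid m.next)
    (show m.next.SameCycle (m.next d) d from Equiv.Perm.sameCycle_apply_left.2 (.refl _ _))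

variable {m} in
theorem faceOf_next_symm (d : m.Dart) : m.faceOf (m.next.symm d) = m.faceOf d := by
  have := faceOf_next (m := m) (m.next.symm d)
  rw [Equiv.apply_symm_apply] at this
  exact this.symm

/-- The darts after the insertion of a point `x` joined to every corner of `f`: to the old darts
one adds, for every side `d` of `f`, the dart `(d, false)` from the origin of `d` to `x` and the
dart `(d, true)` from `x` to the origin of `d`. -/
abbrev InsertDart (f : m.Face) : Type := m.Dart ⊕ ({d : m.Dart // m.faceOf d = f} × Bool)

/-- Reversal of darts after the insertion. -/
def insertInv (f : m.Face) : Equiv.Perm (m.InsertDart f) :=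
  Equiv.sumCongr m.inv (Equiv.prodCongr (Equiv.refl _) Equiv.boolNot)

open Classical in
/-- The face permutation after the insertion: every side `d` of `f` becomes the side of a
triangle `d, (next d, false), (d, true)`; the other faces are unchanged. -/
noncomputable def insertNext (f : m.Face) : Equiv.Perm (m.InsertDart f) where
  toFun
    | .inl d => if h : m.faceOf d = f then .inr (⟨m.next d, (faceOf_next d).trans h⟩, false)
        else .inl (m.next d)
    | .inr (d, false) => .inr (⟨m.next.symm d, (faceOf_next_symm _).trans d.2⟩, true)
    | .inr (d, true) => .inl d
  invFun
    | .inl d => if h : m.faceOf d = f then .inr (⟨d, h⟩, true) else .inl (m.next.symm d)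
    | .inr (d, false) => .inl (m.next.symm d)
    | .inr (d, true) => .inr (⟨m.next d, (faceOf_next _).trans d.2⟩, false)
  left_inv := by
    rintro (d | ⟨⟨d, hd⟩, _ | _⟩)
    · by_cases h : m.faceOf d = f
      · simp [h]
      · simp [h, faceOf_next]
    · simp
    · simp [hd]
  right_inv := by
    rintro (d | ⟨⟨d, hd⟩, _ | _⟩)
    · by_cases h : m.faceOf d = f
      · simp [h]
      · simp [h, faceOf_next_symm]
    · simp [hd, faceOf_next_symm]
    · simp

theorem sameCycle_map {D D' : Type} (p : Equiv.Perm D) (q : Equiv.Perm D') (j : D → D')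
    (h : ∀ d, q.SameCycle (j d) (j (p d))) {a b : D} (hab : p.SameCycle a b) :
    q.SameCycle (j a) (j b) := by
  obtain ⟨i, rfl⟩ := hab
  induction i using Int.induction_on with
  | zero => exact .refl _ _
  | succ n ih =>
    have := h ((p ^ (n : ℤ)) a)
    rw [← Equiv.Perm.mul_apply, ← zpow_one_add, add_comm] at this
    exact ih.trans this
  | pred n ih =>
    have := h ((p ^ (-(n : ℤ) - 1)) a)
    rw [← Equiv.Perm.mul_apply, ← zpow_one_add, add_sub_cancel] at this
    exact ih.trans this.symm

theorem card_orbits {D X : Type} (p : Equiv.Perm D) (g : D → X) (hs : Function.Surjective g)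
    (hinv : ∀ a, g (p a) = g a) (hsep : ∀ a b, g a = g b → p.SameCycle a b) :
    Nat.card (Quotient (Equiv.Perm.SameCycle.setoid p)) = Nat.card X := by
  have key : ∀ a b, p.SameCycle a b → g a = g b := by
    intro a b hab
    have := sameCycle_map p (1 : Equiv.Perm X) g (fun d => by rw [hinv]) hab
    simpa using this
  refine Nat.card_congr (Equiv.ofBijective (Quotient.lift g key) ⟨?_, ?_⟩)
  · intro a b
    induction a using Quotient.inductionOn
    induction b using Quotient.inductionOn
    intro h
    exact Quotient.sound (hsep _ _ h)
  · intro x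
    obtain ⟨a, rfl⟩ := hs x
    exact ⟨Quotient.mk _ a, rfl⟩

open Classical in
theorem insertNext_inl (f : m.Face) (d : m.Dart) : m.insertNext f (.inl d) =
    if h : m.faceOf d = f then .inr (⟨m.next d, (faceOf_next d).trans h⟩, false)
        else .inl (m.next d) := rfl

theorem insertNext_inr_false (f : m.Face) (d : {d : m.Dart // m.faceOf d = f}) :
    m.insertNext f (.inr (d, false)) =
      .inr (⟨m.next.symm d, (faceOf_next_symm _).trans d.2⟩, true) := rfl

theorem insertNext_inr_true (f : m.Face) (d : {d : m.Dart // m.faceOf d = f}) :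
    m.insertNext f (.inr (d, true)) = .inl d.1 := rfl

open Classical in
theorem insertRot_inl (f : m.Face) (d : m.Dart) :
    (m.insertInv f * (m.insertNext f)⁻¹) (.inl d) =
      if h : m.faceOf d = f then .inr (⟨d, h⟩, false) else .inl ((m.inv * m.next⁻¹) d) := by
  rw [Equiv.Perm.mul_apply]
  show m.insertInv f ((m.insertNext f).symm (.inl d)) = _
  by_cases h : m.faceOf d = f
  · simp [h, insertNext, insertInv]
  · simp [h, insertNext, insertInv, Equiv.Perm.inv_def]

theorem insertRot_inr_false (f : m.Face) (d : {d : m.Dart // m.faceOf d = f}) :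
    (m.insertInv f * (m.insertNext f)⁻¹) (.inr (d, false)) = .inl ((m.inv * m.next⁻¹) d.1) := rfl

theorem insertRot_inr_true (f : m.Face) (d : {d : m.Dart // m.faceOf d = f}) :
    (m.insertInv f * (m.insertNext f)⁻¹) (.inr (d, true)) =
      .inr (⟨m.next d, (faceOf_next _).trans d.2⟩, true) := rfl

theorem insert_card_vertex (f : m.Face) :
    Nat.card (VertexOrbit (m.insertInv f) (m.insertNext f)) = Nat.card m.Vertex + 1 := by
  classical
  have := m.finite_dart
  have horig : ∀ d, m.origin ((m.inv * m.next⁻¹) d) = m.origin d := fun d =>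
    Quotient.sound (s := Equiv.Perm.SameCycle.setoid (m.inv * m.next⁻¹))
      (show (m.inv * m.next⁻¹).SameCycle _ _ from Equiv.Perm.sameCycle_apply_left.2 (.refl _ _))
  have h1 : ∀ d h, (m.insertInv f * (m.insertNext f)⁻¹).SameCycle
      (.inl d) (.inr (⟨d, h⟩, false)) := by
    intro d h
    have := insertRot_inl m f d
    rw [dif_pos h] at this
    rw [← this]
    exact Equiv.Perm.sameCycle_apply_right.2 (.refl _ _)
  have h2 : ∀ a b, (m.inv * m.next⁻¹).SameCycle a b →
      (m.insertInv f * (m.insertNext f)⁻¹).SameCycle (.inl a) (.inl b) := by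
    intro a b hab
    refine sameCycle_map _ _ (fun d => (Sum.inl d : m.InsertDart f)) (fun d => ?_) hab
    by_cases h : m.faceOf d = f
    · refine (h1 d h).trans ?_
      rw [show (Sum.inl ((m.inv * m.next⁻¹) d) : m.InsertDart f) = _ from
        (insertRot_inr_false m f ⟨d, h⟩).symm]
      exact Equiv.Perm.sameCycle_apply_right.2 (.refl _ _)
    · have := insertRot_inl m f d
      rw [dif_neg h] at this
      show Equiv.Perm.SameCycle _ _ (Sum.inl ((m.inv * m.next⁻¹) d) : m.InsertDart f)
      rw [← this]
      exact Equiv.Perm.sameCycle_apply_right.2 (.refl _ _)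
  have h3 : ∀ a b : {d : m.Dart // m.faceOf d = f},
      (m.insertInv f * (m.insertNext f)⁻¹).SameCycle (.inr (a, true)) (.inr (b, true)) := by
    rintro ⟨a, ha⟩ ⟨b, hb⟩
    have hab : m.next.SameCycle a b :=
      Quotient.exact (s := Equiv.Perm.SameCycle.setoid m.next) (ha.trans hb.symm)
    have := sameCycle_map m.next (m.insertInv f * (m.insertNext f)⁻¹)
      (fun d => if h : m.faceOf d = f then (Sum.inr (⟨d, h⟩, true) : m.InsertDart f)
        else .inr (⟨a, ha⟩, true)) (fun d => by
        by_cases h : m.faceOf d = f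
        · rw [dif_pos h, dif_pos ((faceOf_next _).trans h)]
          rw [← insertRot_inr_true m f ⟨d, h⟩]
          exact Equiv.Perm.sameCycle_apply_right.2 (.refl _ _)
        · rw [dif_neg h, dif_neg (fun h' => h ((faceOf_next _).symm.trans h'))]) hab
    simpa only [dif_pos ha, dif_pos hb] using this
  rw [← Finite.card_option]
  refine card_orbits _ (fun d : m.InsertDart f => match d with
    | .inl d => some (m.origin d)
    | .inr (d, false) => some (m.origin d.1)
    | .inr (_, true) => none) ?_ ?_ ?_
  · rintro (_ | v)
    · obtain ⟨d, hd⟩ := Quotient.exists_rep f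
      exact ⟨.inr (⟨d, hd⟩, true), rfl⟩
    · obtain ⟨d, rfl⟩ := Quotient.exists_rep v
      exact ⟨.inl d, rfl⟩
  · rintro (d | ⟨d, _ | _⟩)
    · rw [insertRot_inl]
      by_cases h : m.faceOf d = f
      · rw [dif_pos h]
      · rw [dif_neg h]
        exact congrArg some (horig d)
    · rw [insertRot_inr_false]
      exact congrArg some (horig d.1)
    · rw [insertRot_inr_true]
  · have hx : ∀ a b, m.origin a = m.origin b →
        (m.insertInv f * (m.insertNext f)⁻¹).SameCycle (.inl a) (.inl b) := fun a b h =>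
      h2 a b (Quotient.exact (s := Equiv.Perm.SameCycle.setoid (m.inv * m.next⁻¹)) h)
    rintro (a | ⟨a, _ | _⟩) (b | ⟨b, _ | _⟩) h
    · exact hx a b (Option.some.inj h)
    · exact (hx a b.1 (Option.some.inj h)).trans (h1 b.1 b.2)
    · exact absurd h (by simp)
    · exact (h1 a.1 a.2).symm.trans (hx a.1 b (Option.some.inj h))
    · exact ((h1 a.1 a.2).symm.trans (hx a.1 b.1 (Option.some.inj h))).trans (h1 b.1 b.2)
    · exact absurd h (by simp)
    · exact absurd h (by simp)
    · exact absurd h (by simp)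
    · exact h3 a b

theorem insert_card_face (f : m.Face) :
    Nat.card (FaceOrbit (m.insertNext f)) + 1 = Nat.card m.Face + m.faceDegree f := by
  classical
  have := m.finite_dart
  have hcard : Nat.card {g : m.Face // g ≠ f} + 1 = Nat.card m.Face := by
    rw [← Finite.card_option]
    exact Nat.card_congr (Equiv.optionSubtypeNe f)
  have hn1 : ∀ d h, m.insertNext f (.inr (⟨d, h⟩, true)) = .inl d := fun _ _ => rfl
  have h1 : ∀ d h, (m.insertNext f).SameCycle (.inr (⟨d, h⟩, true)) (.inl d) := fun d h => by
    rw [← hn1 d h]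
    exact Equiv.Perm.sameCycle_apply_right.2 (.refl _ _)
  have h2 : ∀ d : {d : m.Dart // m.faceOf d = f}, (m.insertNext f).SameCycle (.inr (d, false))
      (.inr (⟨m.next.symm d, (faceOf_next_symm _).trans d.2⟩, true)) := fun d => by
    rw [← insertNext_inr_false]
    exact Equiv.Perm.sameCycle_apply_right.2 (.refl _ _)
  have hx : ∀ a b, m.faceOf a ≠ f → m.faceOf a = m.faceOf b →
      (m.insertNext f).SameCycle (.inl a) (.inl b) := by
    intro a b ha hab
    have hs : m.next.SameCycle a b :=
      Quotient.exact (s := Equiv.Perm.SameCycle.setoid m.next) hab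
    have := sameCycle_map m.next (m.insertNext f)
      (fun d => if m.faceOf d = f then (Sum.inl a : m.InsertDart f) else .inl d) (fun d => by
        by_cases h : m.faceOf d = f
        · rw [if_pos h, if_pos ((faceOf_next _).trans h)]
        · rw [if_neg h, if_neg (fun h' => h ((faceOf_next _).symm.trans h'))]
          have := insertNext_inl m f d
          rw [dif_neg h] at this
          rw [← this]
          exact Equiv.Perm.sameCycle_apply_right.2 (.refl _ _)) hs
    simpa only [if_neg ha, if_neg (hab ▸ ha)] using this
  have := card_orbits (m.insertNext f)
    (X := {g : m.Face // g ≠ f} ⊕ {d : m.Dart // m.faceOf d = f})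
    (fun d : m.InsertDart f => match d with
    | .inl d => if h : m.faceOf d = f then .inr ⟨d, h⟩ else .inl ⟨m.faceOf d, h⟩
    | .inr (d, false) => .inr ⟨m.next.symm d, (faceOf_next_symm _).trans d.2⟩
    | .inr (d, true) => .inr d) ?_ ?_ ?_
  · unfold faceDegree
    rw [this, Nat.card_sum]
    omega
  · rintro (⟨g, hg⟩ | d)
    · obtain ⟨d, rfl⟩ := Quotient.exists_rep g
      exact ⟨.inl d, dif_neg hg⟩
    · exact ⟨.inr (d, true), rfl⟩
  · rintro (d | ⟨d, _ | _⟩)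
    · rw [insertNext_inl]
      by_cases h : m.faceOf d = f
      · simp only [dif_pos h, Equiv.symm_apply_apply]
      · simp only [dif_neg h, faceOf_next]
    · rw [insertNext_inr_false]
    · rw [insertNext_inr_true]
      exact dif_pos d.2
  · have hall : ∀ x : m.InsertDart f,
        (∃ d, m.faceOf d ≠ f ∧ x = .inl d) ∨ ∃ d : {d : m.Dart // m.faceOf d = f},
        (m.insertNext f).SameCycle x (.inr (d, true)) ∧ (match x with
          | .inl d => if h : m.faceOf d = f then .inr ⟨d, h⟩ else .inl ⟨m.faceOf d, h⟩
          | .inr (d, false) => .inr ⟨m.next.symm d, (faceOf_next_symm _).trans d.2⟩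
          | .inr (d, true) => .inr d :
            {g : m.Face // g ≠ f} ⊕ {d : m.Dart // m.faceOf d = f}) = .inr d := by
      rintro (d | ⟨d, _ | _⟩)
      · by_cases h : m.faceOf d = f
        · exact .inr ⟨⟨d, h⟩, (h1 d h).symm, dif_pos h⟩
        · exact .inl ⟨d, h, rfl⟩
      · exact .inr ⟨_, h2 d, rfl⟩
      · exact .inr ⟨d, .refl _ _, rfl⟩
    intro a b hab
    obtain ⟨a, ha, rfl⟩ | ⟨da, ha, ha'⟩ := hall a <;>
      obtain ⟨b, hb, rfl⟩ | ⟨db, hb, hb'⟩ := hall b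
    · simp only [dif_neg ha, dif_neg hb] at hab
      exact hx a b ha (congrArg Subtype.val (Sum.inl.inj hab))
    · have hab' := hab.trans hb'
      simp only [dif_neg ha] at hab'
      cases hab'
    · have hab' := ha'.symm.trans hab
      simp only [dif_neg hb] at hab'
      cases hab'
    · cases Sum.inr.inj (ha'.symm.trans (hab.trans hb'))
      exact ha.trans hb.symm

/-- The map obtained by drawing a new vertex inside the face `f` and joining it to every corner
of `f`. -/
noncomputable def insert (f : m.Face) : RootedMap where
  Dart := m.InsertDart f
  finite_dart := by
    have := m.finite_dart
    infer_instance
  inv := m.insertInv f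
  next := m.insertNext f
  root := .inl m.root
  inv_inv := by
    rintro (d | ⟨d, _ | _⟩) <;> simp [insertInv, m.inv_inv]
  inv_ne := by
    rintro (d | ⟨d, _ | _⟩) <;> simp [insertInv, m.inv_ne]
  connected := by
    classical
    set R := fun a b : m.InsertDart f => b = m.insertInv f a ∨ b = m.insertNext f a
    have h1 : ∀ d, Relation.EqvGen R (.inr (d, true)) (.inl d.1) := fun d => .rel _ _ (.inr rfl)
    have h2 : ∀ d, Relation.EqvGen R (.inr (d, true)) (.inr (d, false)) := fun d =>
      .rel _ _ (.inl rfl)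
    have h3 : ∀ d d', Relation.EqvGen R (.inl d) (.inl d') := by
      intro d d'
      induction m.connected d d' with
      | rel a b hab =>
        rcases hab with rfl | rfl
        · exact .rel _ _ (.inl rfl)
        · have := insertNext_inl m f a
          by_cases h : m.faceOf a = f
          · rw [dif_pos h] at this
            exact (Relation.EqvGen.rel _ _ (.inr this.symm)).trans _ _ _
              (((h2 _).symm _ _).trans _ _ _ (h1 _))
          · rw [dif_neg h] at this
            exact .rel _ _ (.inr this.symm)
      | refl a => exact .refl _
      | symm a b _ ih => exact ih.symm _ _
      | trans a b c _ _ ih1 ih2 => exact ih1.trans _ _ _ ih2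
    have h4 : ∀ x, Relation.EqvGen R x (.inl m.root) := by
      rintro (d | ⟨d, _ | _⟩)
      · exact h3 _ _
      · exact ((h2 d).symm _ _).trans _ _ _ ((h1 d).trans _ _ _ (h3 _ _))
      · exact (h1 d).trans _ _ _ (h3 _ _)
    exact fun a b => (h4 a).trans _ _ _ ((h4 b).symm _ _)
  euler := by
    have := m.finite_dart
    have h1 := m.insert_card_vertex f
    have h2 := m.insert_card_face f
    have h3 := m.euler
    have h4 : Nat.card (m.InsertDart f) = Nat.card m.Dart + m.faceDegree f * 2 := by
      rw [Nat.card_sum, Nat.card_prod, Nat.card_eq_fintype_card (α := Bool), Fintype.card_bool]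
      rfl
    rw [h4, h1]
    unfold Vertex Face at *
    omega

/-- The rooted triangle.  Its vertices are numbered counterclockwise by `Fin 3`; `(i, true)` is the
edge from `i` to `i + 1` and `(i, false)` is the edge from `i + 1` to `i`. -/
def triangle : RootedMap where
  Dart := Fin 3 × Bool
  finite_dart := inferInstance
  inv := Equiv.prodCongr (Equiv.refl _) Equiv.boolNot
  next :=
    { toFun := fun d => (if d.2 then d.1 + 1 else d.1 - 1, d.2)
      invFun := fun d => (if d.2 then d.1 - 1 else d.1 + 1, d.2)
      left_inv := by decide
      right_inv := by decide }
  root := (0, true)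
  inv_inv := by decide
  inv_ne := by decide
  connected := by
    have h : ∀ (i : Fin 3) (b : Bool), Relation.EqvGen
        (fun x y : Fin 3 × Bool => y = (x.1, !x.2) ∨ y = (if x.2 then x.1 + 1 else x.1 - 1, x.2))
        (i, b) (0, true) := by
      have h0 : ∀ i : Fin 3, Relation.EqvGen
          (fun x y : Fin 3 × Bool => y = (x.1, !x.2) ∨ y = (if x.2 then x.1 + 1 else x.1 - 1, x.2))
          (i, true) (i + 1, true) := fun i => .rel _ _ (.inr rfl)
      have h1 : ∀ i : Fin 3, Relation.EqvGen
          (fun x y : Fin 3 × Bool => y = (x.1, !x.2) ∨ y = (if x.2 then x.1 + 1 else x.1 - 1, x.2))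
          (i, true) (0, true) := by
        intro i
        fin_cases i
        · exact .refl _
        · exact (h0 1).trans _ _ _ (h0 2)
        · exact h0 2
      intro i b
      cases b
      · exact (Relation.EqvGen.rel _ _ (.inl rfl)).trans _ _ _ (h1 i)
      · exact h1 i
    exact fun d d' => (h d.1 d.2).trans _ _ _ ((h d'.1 d'.2).symm _ _)
  euler := by
    have h3 : ∀ (p : Equiv.Perm (Fin 3 × Bool)) a b, (b = a ∨ b = p a ∨ b = p (p a)) →
        p.SameCycle a b := by
      rintro p a b (rfl | rfl | rfl)
      · exact .refl _ _
      · exact Equiv.Perm.sameCycle_apply_right.2 (.refl _ _)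
      · exact Equiv.Perm.sameCycle_apply_right.2 (Equiv.Perm.sameCycle_apply_right.2 (.refl _ _))
    rw [card_orbits _ (fun d : Fin 3 × Bool => if d.2 then d.1 else d.1 + 1) (by decide)
      (by decide) (fun a b h => h3 _ a b (by revert a b; decide)),
      card_orbits _ (fun d : Fin 3 × Bool => d.2) (by decide)
      (by decide) (fun a b h => h3 _ a b (by revert a b; decide))]
    simp

/-- Two rooted maps are isomorphic when a relabelling of the darts preserves all the structure. -/
def Iso (m m' : RootedMap) (e : m.Dart ≃ m'.Dart) : Prop :=
  (∀ d, e (m.inv d) = m'.inv (e d)) ∧ (∀ d, e (m.next d) = m'.next (e d)) ∧ e m.root = m'.root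

theorem Iso.refl (m : RootedMap) : Iso m m (Equiv.refl _) := ⟨fun _ => rfl, fun _ => rfl, rfl⟩

theorem Iso.symm {m m' : RootedMap} {e : m.Dart ≃ m'.Dart} (h : Iso m m' e) :
    Iso m' m e.symm :=
  ⟨fun d => by rw [Equiv.symm_apply_eq, h.1, Equiv.apply_symm_apply],
   fun d => by rw [Equiv.symm_apply_eq, h.2.1, Equiv.apply_symm_apply],
   by rw [Equiv.symm_apply_eq, h.2.2]⟩

theorem Iso.trans {m₁ m₂ m₃ : RootedMap} {e : m₁.Dart ≃ m₂.Dart} {e' : m₂.Dart ≃ m₃.Dart}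
    (h : Iso m₁ m₂ e) (h' : Iso m₂ m₃ e') : Iso m₁ m₃ (e.trans e') :=
  ⟨fun d => by simp [h.1, h'.1], fun d => by simp [h.2.1, h'.2.1], by simp [h.2.2, h'.2.2]⟩

instance isoSetoid : Setoid RootedMap where
  r m m' := ∃ e, Iso m m' e
  iseqv := ⟨fun m => ⟨_, Iso.refl m⟩, fun ⟨_, h⟩ => ⟨_, h.symm⟩,
    fun ⟨_, h⟩ ⟨_, h'⟩ => ⟨_, h.trans h'⟩⟩

end RootedMap

/-- A rooted planar map with a distinguished finite face. -/
structure MarkedMap where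
  map : RootedMap
  face : map.Face
  finite_face : face ∈ map.finiteFaces

/-- Marked maps are identified when an isomorphism of rooted maps matches the marked faces. -/
instance MarkedMap.isoSetoid : Setoid MarkedMap where
  r M M' := ∃ e, RootedMap.Iso M.map M'.map e ∧
    ∀ d, M.map.faceOf d = M.face ↔ M'.map.faceOf (e d) = M'.face
  iseqv := ⟨fun M => ⟨_, .refl M.map, fun _ => Iff.rfl⟩,
    fun ⟨e, h, hf⟩ => ⟨_, h.symm, fun d => by rw [hf, Equiv.apply_symm_apply]⟩,
    fun ⟨_, h, hf⟩ ⟨_, h', hf'⟩ => ⟨_, h.trans h', fun d => (hf d).trans (hf' _)⟩⟩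

/-- Rooted planar maps up to isomorphism. -/
abbrev MapClass : Type 1 := Quotient RootedMap.isoSetoid

/-- Rooted planar maps with a distinguished finite face, up to isomorphism. -/
abbrev MarkedClass : Type 1 := Quotient MarkedMap.isoSetoid

/-- The map underlying a marked map. -/
def MarkedClass.map : MarkedClass → MapClass :=
  Quotient.map MarkedMap.map fun _ _ ⟨e, h, _⟩ => ⟨e, h⟩

/-- The operation `Φ`: insert a vertex in the distinguished finite face. -/
noncomputable def MarkedClass.grow : MarkedClass → MapClass :=
  Quotient.map (fun M => M.map.insert M.face) fun M M' ⟨e, h, hf⟩ => by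
    classical
    refine ⟨Equiv.sumCongr e (Equiv.prodCongr (e.subtypeEquiv hf) (Equiv.refl _)), ?_, ?_, ?_⟩
    · rintro (d | ⟨d, _ | _⟩)
      · exact congrArg Sum.inl (h.1 d)
      · rfl
      · rfl
    · have hs : ∀ d, e (M.map.next.symm d) = M'.map.next.symm (e d) := fun d => by
        rw [Equiv.eq_symm_apply, ← h.2.1, Equiv.apply_symm_apply]
      rintro (d | ⟨d, _ | _⟩)
      · show Equiv.sumCongr _ _ (M.map.insertNext M.face (.inl d)) =
          M'.map.insertNext M'.face (.inl (e d))
        rw [RootedMap.insertNext_inl, RootedMap.insertNext_inl]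
        by_cases hd : M.map.faceOf d = M.face
        · rw [dif_pos hd, dif_pos ((hf d).1 hd)]
          exact congrArg Sum.inr (Prod.ext (Subtype.ext (h.2.1 d)) rfl)
        · rw [dif_neg hd, dif_neg (fun h' => hd ((hf d).2 h'))]
          exact congrArg Sum.inl (h.2.1 d)
      · exact congrArg Sum.inr (Prod.ext (Subtype.ext (hs d)) rfl)
      · rfl
    · exact congrArg Sum.inl h.2.2

/-! ## Stack-triangulations -/

/-- `stackTriangulations k` is the set of stack-triangulations with `2 k` faces, for `k ≥ 1`. -/
def stackTriangulations : ℕ → Set MapClass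
  | 0 => ∅
  | 1 => {Quotient.mk _ RootedMap.triangle}
  | k + 2 => {c | ∃ M : MarkedClass, M.map ∈ stackTriangulations (k + 1) ∧ M.grow = c}

/-- `IsMapHistory h c`: the sequence `h = ((m₁, f₁), …, (m_{k-1}, f_{k-1}))` is a history of `c`,
that is, `m₁` is the triangle, `m_{i+1} = Φ(m_i, f_i)` and `c = Φ(m_{k-1}, f_{k-1})`
(`c` is the triangle when `h` is empty). -/
inductive IsMapHistory : List MarkedClass → MapClass → Prop
  | nil : IsMapHistory [] (Quotient.mk _ RootedMap.triangle)
  | snoc (h : List MarkedClass) (M : MarkedClass) :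
      IsMapHistory h M.map → IsMapHistory (h ++ [M]) M.grow

/-- The histories of the stack-triangulations with `2 k` faces. -/
def mapHistories (k : ℕ) : Set (List MarkedClass) :=
  {h | ∃ c ∈ stackTriangulations k, IsMapHistory h c}

/-! ## Trees -/

/-- Words on the positive integers (positivity of the letters is required in `IsPlanarTree`). -/
abbrev Word : Type := List ℕ

/-- Planar trees as sets of words. -/
structure IsPlanarTree (t : Set Word) : Prop where
  root_mem : [] ∈ t
  parent_mem : ∀ (u : Word) (i : ℕ), u ++ [i] ∈ t → u ∈ t
  pos : ∀ (u : Word) (i : ℕ), u ++ [i] ∈ t → 1 ≤ i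
  sibling_mem : ∀ (u : Word) (i : ℕ), u ++ [i] ∈ t → ∀ j, 1 ≤ j → j ≤ i → u ++ [j] ∈ t

/-- The ranks of the children of `u` in `t`. -/
def childRanks (t : Set Word) (u : Word) : Set ℕ := {i | u ++ [i] ∈ t}

/-- The leaves of a tree. -/
def leaves (t : Set Word) : Set Word := {u | u ∈ t ∧ childRanks t u = ∅}

/-- The internal nodes of a tree. -/
def internalNodes (t : Set Word) : Set Word := {u | u ∈ t ∧ childRanks t u ≠ ∅}

/-- The ternary trees with `n` nodes: every node has `0` or `3` children. -/
def ternaryTrees (n : ℕ) : Set (Set Word) :=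
  {t | IsPlanarTree t ∧ (∀ u ∈ t, childRanks t u = ∅ ∨ childRanks t u = {1, 2, 3}) ∧
    t.encard = n}

/-- Replace the leaf `u` by an internal node with three children. -/
def growTree (t : Set Word) (u : Word) : Set Word := t ∪ {u ++ [1], u ++ [2], u ++ [3]}

/-- `IsTreeHistory h t`: the sequence `h = ((t₁, u₁), …, (t_{k-1}, u_{k-1}))` is a history of `t`,
that is, `t₁` is the tree reduced to its root, `u_i` is a leaf of `t_i`, `t_{i+1}` is obtained from
`t_i` by growing `u_i`, and `t` is obtained in this way from the last pair
(`t` is reduced to its root when `h` is empty). -/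
inductive IsTreeHistory : List (Set Word × Word) → Set Word → Prop
  | nil : IsTreeHistory [] {[]}
  | snoc (h : List (Set Word × Word)) (t : Set Word) (u : Word) :
      IsTreeHistory h t → u ∈ leaves t → IsTreeHistory (h ++ [(t, u)]) (growTree t u)

/-- The histories of the ternary trees with `3 k - 2` nodes, for `k ≥ 1`. -/
def treeHistories (k : ℕ) : Set (List (Set Word × Word)) :=
  {h | ∃ t ∈ ternaryTrees (3 * k - 2), IsTreeHistory h t}

/-! ## The passage function -/

/-- `letterIn u a p q`: the letter `a` occurs in `u_{p+1} … u_q` (letters numbered from `1`). -/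
def letterIn (u : Word) (a : ℕ) (p : ℕ∞) (q : ℕ) : Prop :=
  ∃ r : ℕ, p ≤ r ∧ r < q ∧ u[r]? = some a

/-- The times `τ_j(u)`, `j ≥ 1` (the value at `j = 0` is not used), with `inf ∅ = ∞`. -/
noncomputable def tau (u : Word) : ℕ → ℕ∞
  | 0 => 0
  | 1 => 0
  | 2 => sInf {i : ℕ∞ | ∃ n : ℕ, i = n ∧ 0 < n ∧ u[n - 1]? = some 1}
  | j + 3 => sInf {i : ℕ∞ | ∃ n : ℕ, i = n ∧ n ≤ u.length ∧ tau u (j + 2) < n ∧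
      letterIn u 1 (tau u (j + 2)) n ∧ letterIn u 2 (tau u (j + 2)) n ∧
      letterIn u 3 (tau u (j + 2)) n}

/-- The passage function `Γ(u) = max {i | τ_i(u) ≤ |u|}`. -/
noncomputable def passage (u : Word) : ℕ := sSup {i : ℕ | 1 ≤ i ∧ tau u i ≤ u.length}

/-- The longest common prefix of two words. -/
def meet : Word → Word → Word
  | a :: u, b :: v => if a = b then a :: meet u v else []
  | _, _ => []

/-- The two-parameter passage function: `Γ(w a, w b) = Γ(a) + Γ(b)`, where `w` is the longest
common prefix of the two words. -/
noncomputable def passage₂ (u v : Word) : ℕ :=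
  passage (u.drop (meet u v).length) + passage (v.drop (meet u v).length)

/-- The words `a w` where all the letters of `w` lie in `{b, c}`. -/
def startThen (a b c : ℕ) : Set Word := {w | ∃ x : Word, w = a :: x ∧ ∀ i ∈ x, i = b ∨ i = c}

/-- The "binary" forest below the node `u`: the nodes `u w` of `s` with
`w ∈ 1 {2,3}* ∪ 2 {1,3}* ∪ 3 {1,2}*`. -/
def binaryForest (s : Set Word) (u : Word) : Set Word :=
  {v ∈ s | ∃ w ∈ startThen 1 2 3 ∪ startThen 2 1 3 ∪ startThen 3 1 2, v = u ++ w}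

/-!
A finite face of a stack-triangulation is coded by the leaf `u` that records the insertions leading
to it: inserting a vertex in the triangle `u` creates the triangles `u1`, `u2`, `u3`, the triangle
`ua` being obtained from `u` by replacing its `a`-th corner by the new vertex, which is coded by
`u`. Hence the `a`-th corner of the triangle `u` is read off from the last occurrence of `a` in `u`,
and the darts of the map, which are the sides of its triangles, are labelled by words so that all
the structure of the map is a function of the tree. Such a labelling exists because an insertion
grows a leaf. It is unique: every edge off the infinite face joins an internal vertex to a corner of
the triangle in which it was inserted, and the corners of a triangle determine its word.

The distance from a given vertex to a new vertex is one more than the least distance to a corner of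
the triangle in which it is inserted. The distances to the three corners never differ by more than
one, so this minimum increases by one precisely when all three corners have been replaced since the
last increase, which is what the times `τ_j` record. For two vertices `wax` and `wby` with `a ≠ b`,
a path has to leave the triangles `wa` and `wb`, whose corners are within bounded distance of each
other. Finally, inserting a vertex in a triangle around `w` adds one triangle around `w`, and the
words of these triangles are the `wax` with the letter `a` not occurring in `x`.
-/

namespace RootedMap

/-! ### Vertices, faces and distances -/

section

variable {m m' : RootedMap}

theorem origin_eq_iff_sameCycle {d d' : m.Dart} :
    m.origin d = m.origin d' ↔ (m.inv * m.next⁻¹).SameCycle d d' :=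
  Quotient.eq (r := Equiv.Perm.SameCycle.setoid (m.inv * m.next⁻¹))

theorem faceOf_eq_iff_sameCycle {d d' : m.Dart} :
    m.faceOf d = m.faceOf d' ↔ m.next.SameCycle d d' :=
  Quotient.eq (r := Equiv.Perm.SameCycle.setoid m.next)

theorem origin_surjective : Function.Surjective m.origin := Quotient.exists_rep

theorem faceOf_surjective : Function.Surjective m.faceOf := Quotient.exists_rep

theorem origin_inv (d : m.Dart) : m.origin (m.inv d) = m.origin (m.next d) := by
  have rotation_next : (m.inv * m.next⁻¹) (m.next d) = m.inv d := by simp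
  rw [origin_eq_iff_sameCycle, ← rotation_next]
  exact Equiv.Perm.sameCycle_apply_left.2 (.refl _ _)

theorem eq_of_sameCycle {D : Type} {X : Type*} {p : Equiv.Perm D} {g : D → X}
    (h : ∀ d, g (p d) = g d) {a b : D} (hab : p.SameCycle a b) : g a = g b := by
  simpa using sameCycle_map p (1 : Equiv.Perm Prop) (fun d => g d = g b) (fun d => by rw [h]) hab

theorem eq_of_origin_eq {X : Type*} {g : m.Dart → X} (h : ∀ d, g (m.inv d) = g (m.next d))
    {a b : m.Dart} (hab : m.origin a = m.origin b) : g a = g b := by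
  refine eq_of_sameCycle (fun d => ?_) (origin_eq_iff_sameCycle.1 hab)
  simp [h]

theorem eq_of_faceOf_eq {X : Type*} {g : m.Dart → X} (h : ∀ d, g (m.next d) = g d)
    {a b : m.Dart} (hab : m.faceOf a = m.faceOf b) : g a = g b :=
  eq_of_sameCycle h (faceOf_eq_iff_sameCycle.1 hab)

theorem Iso.origin_eq_iff {e : m.Dart ≃ m'.Dart} (he : Iso m m' e) {a b : m.Dart} :
    m'.origin (e a) = m'.origin (e b) ↔ m.origin a = m.origin b := by
  constructor
  · intro h
    simpa using eq_of_origin_eq (g := fun d => m.origin (e.symm d))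
      (fun d => by rw [he.symm.1, he.symm.2.1, origin_inv]) h
  · exact eq_of_origin_eq (g := fun d => m'.origin (e d))
      fun d => by rw [he.1, he.2.1, origin_inv]

theorem dart_induction {P : m.Dart → Prop} {d₀ : m.Dart} (h₀ : P d₀)
    (hinv : ∀ d, P d ↔ P (m.inv d)) (hnext : ∀ d, P d ↔ P (m.next d)) (d : m.Dart) : P d := by
  suffices h : ∀ a b, Relation.EqvGen (fun a b => b = m.inv a ∨ b = m.next a) a b → (P a ↔ P b) from
    (h _ _ (m.connected d₀ d)).1 h₀
  intro a b h
  induction h with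
  | rel a b h =>
    rcases h with rfl | rfl
    exacts [hinv a, hnext a]
  | refl => rfl
  | symm _ _ _ ih => exact ih.symm
  | trans _ _ _ _ _ ih ih' => exact ih.trans ih'

theorem adj_or_origin_next_eq (d : m.Dart) :
    m.graph.Adj (m.origin d) (m.origin (m.next d)) ∨ m.origin d = m.origin (m.next d) :=
  or_iff_not_imp_right.2 fun h => ⟨h, d, rfl, origin_inv d⟩

theorem connected_graph (m : RootedMap) : m.graph.Connected := by
  have reachable_next : ∀ d : m.Dart, m.graph.Reachable (m.origin d) (m.origin (m.next d)) :=
    fun d => (adj_or_origin_next_eq d).elim SimpleGraph.Adj.reachable fun h => h ▸ .refl _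
  have reachable_iff : ∀ d : m.Dart, m.graph.Reachable m.rootVertex (m.origin d) ↔
      m.graph.Reachable m.rootVertex (m.origin (m.next d)) := fun d =>
    ⟨fun h => h.trans (reachable_next d), fun h => h.trans (reachable_next d).symm⟩
  have reachable : ∀ d : m.Dart, m.graph.Reachable m.rootVertex (m.origin d) :=
    dart_induction (d₀ := m.root) (.refl _) (fun d => by rw [origin_inv]; exact reachable_iff d)
      reachable_iff
  have : Nonempty m.Vertex := ⟨m.rootVertex⟩
  refine ⟨fun v w => ?_⟩
  obtain ⟨d, rfl⟩ := origin_surjective v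
  obtain ⟨d', rfl⟩ := origin_surjective w
  exact (reachable d).symm.trans (reachable d')

theorem dist_self (v : m.Vertex) : m.dist v v = 0 := SimpleGraph.dist_self

theorem dist_comm (v w : m.Vertex) : m.dist v w = m.dist w v := SimpleGraph.dist_comm

theorem dist_triangle (u v w : m.Vertex) : m.dist u w ≤ m.dist u v + m.dist v w :=
  m.connected_graph.dist_triangle

theorem dist_origin_next_le_one (d : m.Dart) :
    m.dist (m.origin d) (m.origin (m.next d)) ≤ 1 := by
  rcases adj_or_origin_next_eq d with h | h
  · exact (SimpleGraph.dist_eq_one_iff_adj.2 h).le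
  · rw [← h, dist_self]
    exact Nat.zero_le _

theorem sub_le_dist {F : m.Vertex → ℤ}
    (hF : ∀ d, F (m.origin d) - F (m.origin (m.next d)) ≤ 1) (v w : m.Vertex) :
    F v - F w ≤ m.dist v w := by
  have sub_le_length : ∀ {x y : m.Vertex} (p : m.graph.Walk x y), F x - F y ≤ p.length := by
    intro x y p
    induction p with
    | nil => simp
    | cons hadj p ih =>
      obtain ⟨-, d, rfl, rfl⟩ := hadj
      have hd := hF d
      rw [← origin_inv] at hd
      change _ ≤ ((p.length + 1 : ℕ) : ℤ)
      push_cast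
      linarith
  obtain ⟨p, hp⟩ := m.connected_graph.exists_walk_length_eq_dist v w
  exact (sub_le_length p).trans_eq (congrArg _ hp)

end

/-! ### Darts around an inserted vertex -/

section

variable {m : RootedMap} {f : m.Face}

/-- The three darts of `m.insert f` attached to a side `d` of `f`: the dart `d` itself, the dart
from the new vertex to the origin of `d`, and its inverse. -/
def sideDart (d : {d : m.Dart // m.faceOf d = f}) : Option Bool → m.InsertDart f
  | none => .inl d
  | some b => .inr (d, b)

theorem exists_eq_sideDart (x : m.InsertDart f) :
    (∃ d, m.faceOf d ≠ f ∧ x = .inl d) ∨ ∃ d o, x = sideDart d o := by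
  obtain d | ⟨d, b⟩ := x
  · by_cases hd : m.faceOf d = f
    exacts [.inr ⟨⟨d, hd⟩, none, rfl⟩, .inl ⟨d, hd, rfl⟩]
  · exact .inr ⟨d, some b, rfl⟩

theorem insert_next_inl_of_ne {d : m.Dart} (hd : m.faceOf d ≠ f) :
    (m.insert f).next (.inl d) = .inl (m.next d) := by
  classical
  exact (m.insertNext_inl f d).trans (dif_neg hd)

theorem insert_next_inl_of_eq (d : {d : m.Dart // m.faceOf d = f}) :
    (m.insert f).next (.inl d.1) =
      .inr (⟨m.next d, (faceOf_next d.1).trans d.2⟩, false) := by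
  classical
  exact (m.insertNext_inl f d).trans (dif_pos d.2)

theorem insert_origin_false (d : {d : m.Dart // m.faceOf d = f}) :
    (m.insert f).origin (.inr (d, false)) = (m.insert f).origin (.inl d.1) :=
  origin_inv (m := m.insert f) (.inr (d, true))

theorem insert_origin_inl {d d' : m.Dart} (h : m.origin d = m.origin d') :
    (m.insert f).origin (.inl d) = (m.insert f).origin (.inl d') := by
  refine eq_of_origin_eq (g := fun d => (m.insert f).origin (.inl d)) (fun d => ?_) h
  refine (origin_inv (m := m.insert f) (.inl d)).trans ?_
  by_cases hd : m.faceOf d = f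
  · rw [insert_next_inl_of_eq ⟨d, hd⟩, insert_origin_false]
  · rw [insert_next_inl_of_ne hd]

theorem insert_origin_true (d d' : {d : m.Dart // m.faceOf d = f}) :
    (m.insert f).origin (.inr (d, true)) = (m.insert f).origin (.inr (d', true)) := by
  have origin_next : ∀ d (hd : m.faceOf d = f) (hd' : m.faceOf (m.next d) = f),
      (m.insert f).origin (.inr (⟨m.next d, hd'⟩, true)) =
        (m.insert f).origin (.inr (⟨d, hd⟩, true)) := fun d hd hd' => by
    refine (origin_inv (m := m.insert f) (.inr (⟨m.next d, hd'⟩, false))).trans ?_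
    exact congrArg (fun d => (m.insert f).origin (.inr (d, true)))
      (Subtype.ext (m.next.symm_apply_apply d))
  have invariant := eq_of_faceOf_eq
    (g := fun a => ∀ ha : m.faceOf a = f, (m.insert f).origin (.inr (⟨a, ha⟩, true)) =
      (m.insert f).origin (.inr (d', true))) (fun a => propext ?_) (d.2.trans d'.2.symm)
  · exact invariant.mpr (fun _ => rfl) d.2
  · exact ⟨fun hnext ha => (origin_next a ha _).symm.trans (hnext ((faceOf_next a).trans ha)),
      fun h ha => (origin_next a ((faceOf_next a).symm.trans ha) ha).trans (h _)⟩

end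

end RootedMap

namespace StackTriangulation

/-! ### Letters and corners -/

section

/-- The letter attached to a corner of a triangle. -/
def letter (s : Fin 3) : ℕ := s + 1

@[simp] theorem letter_inj {s s' : Fin 3} : letter s = letter s' ↔ s = s' := by
  simp [letter, Fin.ext_iff]

theorem exists_letter_eq_iff {a : ℕ} : (∃ s, letter s = a) ↔ a ∈ ({1, 2, 3} : Set ℕ) := by
  constructor
  · rintro ⟨s, rfl⟩
    fin_cases s <;> simp [letter]
  · rintro (rfl | rfl | rfl)
    exacts [⟨0, rfl⟩, ⟨1, rfl⟩, ⟨2, rfl⟩]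

/-- Labels of the vertices of a stack-triangulation: the word of the triangle in which an internal
vertex was inserted, or the number of a vertex of the outer triangle. -/
abbrev VertexLabel : Type := Word ⊕ Fin 3

/-- The corners of the triangle coded by a word. The child of rank `letter s` of a triangle is
obtained by replacing the corner `s` by the inserted vertex, so the corner `s` of `u` is the vertex
inserted just before the last occurrence of `letter s` in `u`. -/
def corner (u : Word) (s : Fin 3) : VertexLabel :=
  match u.reverse.dropWhile (· ≠ letter s) with
  | [] => .inr s
  | _ :: w => .inl w.reverse

@[simp] theorem corner_nil (s : Fin 3) : corner [] s = .inr s := rfl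

theorem corner_snoc (u : Word) (a : ℕ) (s : Fin 3) :
    corner (u ++ [a]) s = if a = letter s then .inl u else corner u s := by
  by_cases h : a = letter s <;> simp [corner, h]

theorem corner_snoc_self (u : Word) (s : Fin 3) : corner (u ++ [letter s]) s = .inl u := by
  simp [corner_snoc]

theorem corner_snoc_of_ne (u : Word) {a : ℕ} {s : Fin 3} (h : a ≠ letter s) :
    corner (u ++ [a]) s = corner u s := by
  simp [corner_snoc, h]

theorem corner_append_of_notMem (w y : Word) (s : Fin 3) (h : letter s ∉ y) :
    corner (w ++ y) s = corner w s := by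
  induction y using List.reverseRecOn with
  | nil => simp
  | append_singleton y a ih =>
    simp only [List.mem_append, List.mem_singleton, not_or] at h
    rw [← List.append_assoc, corner_snoc_of_ne _ (Ne.symm h.2), ih h.1]

theorem corner_append_cons (w y : Word) (s : Fin 3) (h : letter s ∉ y) :
    corner (w ++ letter s :: y) s = .inl w := by
  rw [List.append_cons, corner_append_of_notMem _ _ _ h, corner_snoc_self]

theorem corner_eq_inl_iff {u w : Word} {s : Fin 3} :
    corner u s = .inl w ↔ ∃ y, u = w ++ letter s :: y ∧ letter s ∉ y := by
  constructor
  · intro h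
    induction u using List.reverseRecOn with
    | nil => simp at h
    | append_singleton u a ih =>
      rw [corner_snoc] at h
      split_ifs at h with ha
      · cases h
        exact ⟨[], by simp [ha], by simp⟩
      · obtain ⟨y, rfl, hy⟩ := ih h
        exact ⟨y ++ [a], by simp, by simp [hy, Ne.symm ha]⟩
  · rintro ⟨y, rfl, hy⟩
    exact corner_append_cons _ _ _ hy

theorem corner_eq_inr_iff {u : Word} {s i : Fin 3} :
    corner u s = .inr i ↔ i = s ∧ letter s ∉ u := by
  constructor
  · intro h
    induction u using List.reverseRecOn with
    | nil => simpa [eq_comm] using h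
    | append_singleton u a ih =>
      rw [corner_snoc] at h
      split_ifs at h with ha
      simp [ih h, Ne.symm ha]
  · rintro ⟨rfl, h⟩
    simpa using corner_append_of_notMem [] u i h

theorem length_lt_of_corner_eq_inl {u w : Word} {s : Fin 3} (h : corner u s = .inl w) :
    w.length < u.length := by
  obtain ⟨y, rfl, -⟩ := corner_eq_inl_iff.1 h
  simp

theorem corner_injective (u : Word) : Function.Injective (corner u) := by
  induction u using List.reverseRecOn with
  | nil => exact fun s s' h => by simpa using h
  | append_singleton u a ih =>
    have corner_ne : ∀ s, corner u s ≠ .inl u := fun s h => (length_lt_of_corner_eq_inl h).false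
    intro s s' h
    rw [corner_snoc, corner_snoc] at h
    split_ifs at h with hs hs' hs'
    · exact letter_inj.1 (hs.symm.trans hs')
    · exact absurd h.symm (corner_ne _)
    · exact absurd h (corner_ne _)
    · exact ih h

/-! ### Ternary trees -/

/-- Finite planar trees in which every node has `0` or `3` children. -/
structure IsTernaryTree (t : Set Word) : Prop extends IsPlanarTree t where
  childRanks_eq : ∀ u ∈ t, childRanks t u = ∅ ∨ childRanks t u = {1, 2, 3}
  finite : t.Finite

variable {t : Set Word} {u v w : Word}

theorem mem_leaves_iff : u ∈ leaves t ↔ u ∈ t ∧ ∀ a, u ++ [a] ∉ t := by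
  simp [leaves, childRanks, Set.eq_empty_iff_forall_notMem]

theorem mem_internalNodes_iff : u ∈ internalNodes t ↔ u ∈ t ∧ ∃ a, u ++ [a] ∈ t := by
  simp [internalNodes, childRanks, Set.eq_empty_iff_forall_notMem]

theorem mem_leaves_or_mem_internalNodes (h : u ∈ t) : u ∈ leaves t ∨ u ∈ internalNodes t :=
  (em (childRanks t u = ∅)).imp (⟨h, ·⟩) (⟨h, ·⟩)

theorem notMem_leaves_of_mem_internalNodes (h : u ∈ internalNodes t) : u ∉ leaves t :=
  fun hu => h.2 hu.2

namespace IsTernaryTree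

theorem singleton_nil : IsTernaryTree {[]} where
  root_mem := rfl
  parent_mem := by simp
  pos := by simp
  sibling_mem := by simp
  childRanks_eq _ _ := .inl (by simp [childRanks])
  finite := Set.finite_singleton _

theorem mem_of_append_mem (ht : IsTernaryTree t) (h : u ++ v ∈ t) : u ∈ t := by
  induction v using List.reverseRecOn with
  | nil => simpa using h
  | append_singleton v a ih =>
    rw [← List.append_assoc] at h
    exact ih (ht.parent_mem _ _ h)

theorem exists_letter_eq (ht : IsTernaryTree t) {a : ℕ} (h : u ++ [a] ∈ t) :
    ∃ s, letter s = a := by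
  rw [exists_letter_eq_iff]
  have ha : a ∈ childRanks t u := h
  rcases ht.childRanks_eq u (ht.mem_of_append_mem h) with hu | hu
  · simp [hu] at ha
  · rwa [hu] at ha

theorem exists_letter_eq_of_mem (ht : IsTernaryTree t) {a : ℕ} (h : u ∈ t) (ha : a ∈ u) :
    ∃ s, letter s = a := by
  obtain ⟨x, y, rfl⟩ := List.append_of_mem ha
  rw [List.append_cons] at h
  exact ht.exists_letter_eq (ht.mem_of_append_mem h)

theorem snoc_letter_mem (ht : IsTernaryTree t) (h : u ∈ internalNodes t) (s : Fin 3) :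
    u ++ [letter s] ∈ t := by
  have hu := (ht.childRanks_eq u h.1).resolve_left h.2
  change letter s ∈ childRanks t u
  exact hu ▸ exists_letter_eq_iff.1 ⟨s, rfl⟩

theorem mem_internalNodes_of_append_cons_mem (ht : IsTernaryTree t) {a : ℕ}
    (h : u ++ a :: v ∈ t) : u ∈ internalNodes t := by
  rw [List.append_cons] at h
  have ha := ht.mem_of_append_mem h
  exact mem_internalNodes_iff.2 ⟨ht.mem_of_append_mem ha, a, ha⟩

theorem mem_internalNodes_of_corner (ht : IsTernaryTree t) {s : Fin 3} (hu : u ∈ t)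
    (h : corner u s = .inl w) : w ∈ internalNodes t := by
  obtain ⟨y, rfl, -⟩ := corner_eq_inl_iff.1 h
  exact ht.mem_internalNodes_of_append_cons_mem hu

theorem eq_nil_of_append_mem (ht : IsTernaryTree t) (hu : u ∈ leaves t) (h : u ++ v ∈ t) :
    v = [] := by
  cases v with
  | nil => rfl
  | cons a v =>
    exact absurd hu (notMem_leaves_of_mem_internalNodes (ht.mem_internalNodes_of_append_cons_mem h))

theorem exists_append_replicate_mem_leaves (ht : IsTernaryTree t) (hw : w ∈ t) (c : Fin 3) :
    ∃ k, w ++ List.replicate k (letter c) ∈ leaves t := by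
  by_contra! hno
  have mem : ∀ k, w ++ List.replicate k (letter c) ∈ t := by
    intro k
    induction k with
    | zero => simpa using hw
    | succ k ih =>
      have := ht.snoc_letter_mem ((mem_leaves_or_mem_internalNodes ih).resolve_left (hno k)) c
      rwa [List.append_assoc, ← List.replicate_succ'] at this
  refine Set.infinite_of_injective_forall_mem (f := fun k => w ++ List.replicate k (letter c))
    (fun a b hab => ?_) mem ht.finite
  simpa using congrArg List.length hab

/-- Appending the letter of the third corner preserves the two others. -/
theorem exists_leaf_corner_eq (ht : IsTernaryTree t) (hw : w ∈ t) (s s' : Fin 3) :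
    ∃ u ∈ leaves t, corner u s = corner w s ∧ corner u s' = corner w s' := by
  obtain ⟨c, hc, hc'⟩ : ∃ c : Fin 3, c ≠ s ∧ c ≠ s' := by revert s s'; decide
  obtain ⟨k, hk⟩ := ht.exists_append_replicate_mem_leaves hw c
  have letter_notMem : ∀ r, c ≠ r → letter r ∉ List.replicate k (letter c) := fun r hr h =>
    hr (letter_inj.1 (List.eq_of_mem_replicate h).symm)
  exact ⟨_, hk, corner_append_of_notMem _ _ _ (letter_notMem _ hc),
    corner_append_of_notMem _ _ _ (letter_notMem _ hc')⟩

end IsTernaryTree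

/-! ### Growing and pruning -/

theorem mem_growTree_iff : v ∈ growTree t u ↔ v ∈ t ∨ ∃ s, v = u ++ [letter s] := by
  simp only [growTree, letter, Fin.exists_fin_succ, Set.mem_union, Set.mem_insert_iff,
    Set.mem_singleton_iff]
  simp [or_comm]

theorem snoc_mem_growTree_iff {a : ℕ} :
    v ++ [a] ∈ growTree t u ↔ v ++ [a] ∈ t ∨ (v = u ∧ ∃ s, letter s = a) := by
  simp [mem_growTree_iff, eq_comm]

theorem childRanks_growTree_self (hu : u ∈ leaves t) :
    childRanks (growTree t u) u = {1, 2, 3} := by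
  ext a
  change u ++ [a] ∈ growTree t u ↔ _
  simp only [snoc_mem_growTree_iff, (mem_leaves_iff.1 hu).2, exists_letter_eq_iff, true_and,
    false_or]

theorem childRanks_growTree_of_ne (h : v ≠ u) :
    childRanks (growTree t u) v = childRanks t v := by
  ext a
  simp [childRanks, snoc_mem_growTree_iff, h]

theorem encard_growTree (hu : u ∈ leaves t) : (growTree t u).encard = t.encard + 3 := by
  have hnot := (mem_leaves_iff.1 hu).2
  rw [growTree, Set.encard_union_eq]
  · congr 1
    rw [Set.encard_insert_of_notMem (by simp), Set.encard_pair (by simp)]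
    norm_num
  · rw [Set.disjoint_left]
    rintro v hv (rfl | rfl | rfl)
    exacts [hnot _ hv, hnot _ hv, hnot _ hv]

/-- The tree obtained by removing the children of a node; it undoes `growTree`. -/
def pruneTree (t : Set Word) (w : Word) : Set Word := {v ∈ t | ∀ a, v ≠ w ++ [a]}

theorem snoc_mem_pruneTree_iff {a : ℕ} : v ++ [a] ∈ pruneTree t w ↔ v ++ [a] ∈ t ∧ v ≠ w := by
  simp [pruneTree]

theorem childRanks_pruneTree_self : childRanks (pruneTree t w) w = ∅ := by
  simp [childRanks, snoc_mem_pruneTree_iff]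

theorem childRanks_pruneTree_of_ne (h : v ≠ w) : childRanks (pruneTree t w) v = childRanks t v := by
  simp [childRanks, snoc_mem_pruneTree_iff, h]

namespace IsTernaryTree

theorem childRanks_growTree_snoc (ht : IsTernaryTree t) (hu : u ∈ leaves t) (a : ℕ) :
    childRanks (growTree t u) (u ++ [a]) = ∅ := by
  rw [childRanks_growTree_of_ne (by simp)]
  exact Set.eq_empty_of_forall_notMem fun _ h =>
    (mem_leaves_iff.1 hu).2 a (ht.mem_of_append_mem h)

protected theorem growTree (ht : IsTernaryTree t) (hu : u ∈ leaves t) :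
    IsTernaryTree (growTree t u) where
  root_mem := .inl ht.root_mem
  parent_mem v i h := by
    rcases snoc_mem_growTree_iff.1 h with h | ⟨rfl, -⟩
    exacts [.inl (ht.parent_mem _ _ h), .inl hu.1]
  pos v i h := by
    rcases snoc_mem_growTree_iff.1 h with h | ⟨rfl, s, rfl⟩
    exacts [ht.pos _ _ h, Nat.le_add_left _ _]
  sibling_mem v i h j hj hji := by
    rcases snoc_mem_growTree_iff.1 h with h | ⟨rfl, hi⟩
    · exact .inl (ht.sibling_mem _ _ h j hj hji)
    · refine snoc_mem_growTree_iff.2 (.inr ⟨rfl, exists_letter_eq_iff.2 ?_⟩)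
      rw [exists_letter_eq_iff] at hi
      simp only [Set.mem_insert_iff, Set.mem_singleton_iff] at hi ⊢
      omega
  childRanks_eq v hv := by
    rcases mem_growTree_iff.1 hv with h | ⟨s, rfl⟩
    · rcases eq_or_ne v u with rfl | hvu
      · exact .inr (childRanks_growTree_self hu)
      · rw [childRanks_growTree_of_ne hvu]
        exact ht.childRanks_eq v h
    · exact .inl (ht.childRanks_growTree_snoc hu _)
  finite := ht.finite.union (by simp)

theorem mem_leaves_growTree_iff (ht : IsTernaryTree t) (hu : u ∈ leaves t) :
    v ∈ leaves (growTree t u) ↔ (v ∈ leaves t ∧ v ≠ u) ∨ ∃ s, v = u ++ [letter s] := by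
  rcases eq_or_ne v u with rfl | hvu
  · simp [leaves, childRanks_growTree_self hu, (Set.insert_nonempty _ _).ne_empty]
  · by_cases hv : ∃ s, v = u ++ [letter s]
    · obtain ⟨s, rfl⟩ := hv
      simp [leaves, ht.childRanks_growTree_snoc hu, mem_growTree_iff]
    · simp [leaves, childRanks_growTree_of_ne hvu, mem_growTree_iff, hv, hvu]

theorem internalNodes_growTree (ht : IsTernaryTree t) (hu : u ∈ leaves t) :
    internalNodes (growTree t u) = insert u (internalNodes t) := by
  ext v
  rcases eq_or_ne v u with rfl | hvu
  · simp [internalNodes, childRanks_growTree_self hu, mem_growTree_iff, hu.1,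
      (Set.insert_nonempty _ _).ne_empty]
  · by_cases hv : ∃ s, v = u ++ [letter s]
    · obtain ⟨s, rfl⟩ := hv
      have snoc_notMem : u ++ [letter s] ∉ t := (mem_leaves_iff.1 hu).2 _
      simp [internalNodes, ht.childRanks_growTree_snoc hu, snoc_notMem]
    · simp [internalNodes, childRanks_growTree_of_ne hvu, mem_growTree_iff, hv, hvu]

protected theorem pruneTree (ht : IsTernaryTree t) (hw : ∀ a, w ++ [a] ∉ internalNodes t) :
    IsTernaryTree (pruneTree t w) where
  root_mem := ⟨ht.root_mem, by simp⟩
  parent_mem v i h := by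
    have hvi := (snoc_mem_pruneTree_iff.1 h).1
    refine ⟨ht.parent_mem v i hvi, ?_⟩
    rintro a rfl
    exact hw a (mem_internalNodes_iff.2 ⟨ht.parent_mem _ _ hvi, i, hvi⟩)
  pos v i h := ht.pos v i h.1
  sibling_mem v i h j hj hji := by
    rw [snoc_mem_pruneTree_iff] at h ⊢
    exact ⟨ht.sibling_mem v i h.1 j hj hji, h.2⟩
  childRanks_eq v hv := by
    rcases eq_or_ne v w with rfl | hvw
    · exact .inl childRanks_pruneTree_self
    · rw [childRanks_pruneTree_of_ne hvw]
      exact ht.childRanks_eq v hv.1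
  finite := ht.finite.subset fun _ hv => hv.1

theorem growTree_pruneTree (ht : IsTernaryTree t) (hw : w ∈ internalNodes t) :
    _root_.growTree (StackTriangulation.pruneTree t w) w = t := by
  ext v
  rw [mem_growTree_iff]
  constructor
  · rintro (h | ⟨s, rfl⟩)
    exacts [h.1, ht.snoc_letter_mem hw s]
  · refine fun hv => or_iff_not_imp_right.2 fun hne => ⟨hv, ?_⟩
    rintro a rfl
    obtain ⟨s, rfl⟩ := ht.exists_letter_eq hv
    exact hne ⟨s, rfl⟩

theorem eq_singleton_nil (ht : IsTernaryTree t) (h : internalNodes t = ∅) : t = {[]} := by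
  refine Set.eq_singleton_iff_unique_mem.2 ⟨ht.root_mem, fun v hv => ?_⟩
  have nil_mem_leaves : [] ∈ leaves t :=
    (mem_leaves_or_mem_internalNodes ht.root_mem).resolve_right (by simp [h])
  exact ht.eq_nil_of_append_mem nil_mem_leaves hv

theorem exists_eq_growTree (ht : IsTernaryTree t) (h : (internalNodes t).Nonempty) :
    ∃ t₀ w, IsTernaryTree t₀ ∧ w ∈ leaves t₀ ∧ t = _root_.growTree t₀ w := by
  obtain ⟨w, hw, hmax⟩ := Set.exists_max_image (internalNodes t) List.length
    (ht.finite.subset fun v hv => hv.1) h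
  have snoc_notMem : ∀ a, w ++ [a] ∉ internalNodes t := fun a ha => by simpa using hmax _ ha
  exact ⟨_, w, ht.pruneTree snoc_notMem, ⟨⟨hw.1, by simp⟩, childRanks_pruneTree_self⟩,
    (ht.growTree_pruneTree hw).symm⟩

theorem induction {P : Set Word → Prop} (singleton_nil : P {[]})
    (growTree : ∀ t u, IsTernaryTree t → u ∈ leaves t → P t → P (_root_.growTree t u))
    (ht : IsTernaryTree t) : P t := by
  induction hn : t.ncard using Nat.strong_induction_on generalizing t with
  | _ n ih =>
    rcases (internalNodes t).eq_empty_or_nonempty with h | h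
    · rwa [ht.eq_singleton_nil h]
    · obtain ⟨t₀, w, ht₀, hw, rfl⟩ := ht.exists_eq_growTree h
      have hcard : t₀.ncard < (_root_.growTree t₀ w).ncard :=
        Set.ncard_lt_ncard ⟨fun v hv => .inl hv, fun hsub =>
          (mem_leaves_iff.1 hw).2 _ (hsub (.inr (.inl rfl)))⟩ ht.finite
      exact growTree _ _ ht₀ hw (ih _ (hn ▸ hcard) ht₀ rfl)

end IsTernaryTree

end

/-! ### Sides of the triangles -/

section

theorem exists_eq_meet_append (u v : Word) : ∃ a b, u = meet u v ++ a ∧ v = meet u v ++ b ∧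
    ∀ c ∈ a.head?, c ∉ b.head? := by
  induction u generalizing v with
  | nil => exact ⟨[], v, rfl, rfl, by simp⟩
  | cons c u ih =>
    cases v with
    | nil => exact ⟨c :: u, [], rfl, rfl, by simp⟩
    | cons d v =>
      rcases eq_or_ne c d with rfl | h
      · obtain ⟨a, b, hu, hv, hab⟩ := ih v
        rw [meet, if_pos rfl]
        exact ⟨a, b, congrArg (c :: ·) hu, congrArg (c :: ·) hv, hab⟩
      · rw [meet, if_neg h]
        exact ⟨c :: u, d :: v, rfl, rfl, by simpa using h.symm⟩

theorem append_cons_eq_append_cons {x y w z : Word} {a b : ℕ}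
    (h : x ++ a :: y = w ++ b :: z) :
    (∃ r, w = x ++ a :: r) ∨ (w = x ∧ b = a) ∨ ∃ r, x = w ++ b :: r ∧ z = r ++ a :: y := by
  rcases List.append_eq_append_iff.1 h with ⟨_ | ⟨c, r⟩, hw, hr⟩ | ⟨_ | ⟨c, r⟩, hx, hr⟩
  · simp only [List.nil_append, List.cons.injEq] at hr
    exact .inr (.inl ⟨by simpa using hw, hr.1.symm⟩)
  · simp only [List.cons_append, List.cons.injEq] at hr
    exact .inl ⟨r, by rw [hw, hr.1]⟩
  · simp only [List.nil_append, List.cons.injEq] at hr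
    exact .inr (.inl ⟨by simpa using hx.symm, hr.1⟩)
  · simp only [List.cons_append, List.cons.injEq] at hr
    exact .inr (.inr ⟨r, by rw [hx, hr.1], hr.2⟩)

/-- A corner shared by two triangles on both sides of a fork is either inserted at the fork or
inherited from above it. -/
theorem corner_eq_of_fork {x y y' : Word} {a b : ℕ} {s s' : Fin 3} (hab : a ≠ b)
    (h : corner (x ++ a :: y) s = corner (x ++ b :: y') s') :
    (letter s = a ∧ letter s' = b) ∨ (s = s' ∧ letter s ≠ a ∧ letter s ≠ b) := by
  cases hc : corner (x ++ a :: y) s with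
  | inr i =>
    obtain ⟨rfl, hs⟩ := corner_eq_inr_iff.1 hc
    obtain ⟨rfl, hs'⟩ := corner_eq_inr_iff.1 (h.symm.trans hc)
    simp only [List.mem_append, List.mem_cons, not_or] at hs hs'
    exact .inr ⟨rfl, hs.2.1, hs'.2.1⟩
  | inl w =>
    obtain ⟨z, hw, hz⟩ := corner_eq_inl_iff.1 hc
    obtain ⟨z', hw', hz'⟩ := corner_eq_inl_iff.1 (h.symm.trans hc)
    rcases append_cons_eq_append_cons hw with ⟨r, rfl⟩ | ⟨rfl, rfl⟩ | ⟨r, rfl, rfl⟩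
    · simp [hab.symm] at hw'
    · simp only [List.append_cancel_left_eq, List.cons.injEq] at hw'
      exact .inl ⟨rfl, hw'.1.symm⟩
    · simp only [List.append_assoc, List.cons_append, List.append_cancel_left_eq, List.cons.injEq,
        letter_inj] at hw'
      obtain ⟨rfl, rfl⟩ := hw'
      simp only [List.mem_append, List.mem_cons, not_or] at hz hz'
      exact .inr ⟨rfl, hz.2.1, hz'.2.1⟩

/-- Labels of the darts of a stack-triangulation: `(some u, s)` is the side of the triangle coded by
the leaf `u` that starts at its corner `s`, and `(none, s)` is a side of the infinite face, whose
sides are traversed in the opposite order of corners. -/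
abbrev DartLabel : Type := Option Word × Fin 3

/-- The labels of the darts of the stack-triangulation coded by `t`. -/
def labels (t : Set Word) : Set DartLabel := {p | ∀ u, p.1 = some u → u ∈ leaves t}

/-- The label of the origin of a dart. -/
def org : DartLabel → VertexLabel
  | (none, s) => .inr (-s)
  | (some u, s) => corner u s

/-- The label of the next dart of the same face. -/
def nxt (p : DartLabel) : DartLabel := (p.1, p.2 + 1)

variable {t : Set Word} {u v : Word} {s s' : Fin 3}

theorem some_mem_labels : (some u, s) ∈ labels t ↔ u ∈ leaves t := by
  simp [labels]

theorem none_mem_labels : (none, s) ∈ labels t := by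
  simp [labels]

theorem exists_fork (ht : IsTernaryTree t) (hu : u ∈ leaves t) (hv : v ∈ leaves t) (h : u ≠ v) :
    ∃ x y z a b, a ≠ b ∧ u = x ++ a :: y ∧ v = x ++ b :: z := by
  obtain ⟨a, b, hua, hvb, hab⟩ := exists_eq_meet_append u v
  rcases a with _ | ⟨a, y⟩
  · rw [List.append_nil] at hua
    rw [← hua] at hvb
    simp [ht.eq_nil_of_append_mem hu (hvb ▸ hv.1), h.symm] at hvb
  rcases b with _ | ⟨b, z⟩
  · rw [List.append_nil] at hvb
    rw [← hvb] at hua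
    simp [ht.eq_nil_of_append_mem hv (hua ▸ hu.1), h] at hua
  exact ⟨_, y, z, a, b, by simpa [eq_comm] using hab, hua, hvb⟩

theorem leaf_eq_of_corner_eq (ht : IsTernaryTree t) (hu : u ∈ leaves t) (hv : v ∈ leaves t)
    (h : corner u s = corner v s') (h' : corner u (s + 1) = corner v (s' + 1)) : u = v := by
  by_contra hne
  obtain ⟨x, y, z, a, b, hab, rfl, rfl⟩ := exists_fork ht hu hv hne
  obtain ⟨r, rfl⟩ := ht.exists_letter_eq_of_mem hu.1 (a := a) (by simp)
  obtain ⟨r', rfl⟩ := ht.exists_letter_eq_of_mem hv.1 (a := b) (by simp)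
  have fork := corner_eq_of_fork hab h
  have fork' := corner_eq_of_fork hab h'
  simp only [letter_inj, ne_eq] at fork fork' hab
  clear h h' hu hv hne
  revert s s' r r'
  decide

theorem labels_inj (ht : IsTernaryTree t) {p p' : DartLabel} (hp : p ∈ labels t)
    (hp' : p' ∈ labels t) (h : org p = org p') (h' : org (nxt p) = org (nxt p')) : p = p' := by
  have orientation : ∀ {u : Word} {s s' : Fin 3}, org (none, s) = org (some u, s') →
      org (nxt (none, s)) ≠ org (nxt (some u, s')) := fun {u s s'} h h' => by
    have hs : -s = s' := (corner_eq_inr_iff.1 h.symm).1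
    have hs' : -(s + 1) = s' + 1 := (corner_eq_inr_iff.1 h'.symm).1
    clear h h'
    revert s s'
    decide
  obtain ⟨_ | u, s⟩ := p <;> obtain ⟨_ | v, s'⟩ := p'
  · simpa [org] using h
  · exact absurd h' (orientation h)
  · exact absurd h'.symm (orientation h.symm)
  · obtain rfl := leaf_eq_of_corner_eq ht (some_mem_labels.1 hp) (some_mem_labels.1 hp') h h'
    rw [corner_injective u h]

end

/-! ### Codings of a map by a tree -/

section

/-- `Coding m t lab` says that `lab` codes the map `m` by the tree `t`: it identifies the darts of
`m` with the sides of the triangles coded by the leaves of `t`, together with the three sides of the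
infinite face, and two darts have the same origin exactly when their labels do. -/
structure Coding (m : RootedMap) (t : Set Word) (lab : m.Dart → DartLabel) : Prop where
  bij : Set.BijOn lab Set.univ (labels t)
  next : ∀ d, lab (m.next d) = nxt (lab d)
  root : lab (m.inv m.root) = (none, 2)
  inv : ∀ d, org (lab (m.inv d)) = org (lab (m.next d))
  vert : ∀ d d', org (lab d) = org (lab d') → m.origin d = m.origin d'

/-- `HasFaceLabel lab f u` says that `u` is the leaf coding the finite face `f`. -/
def HasFaceLabel {m : RootedMap} (lab : m.Dart → DartLabel) (f : m.Face) (u : Word) : Prop :=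
  ∀ d, m.faceOf d = f ↔ (lab d).1 = some u

variable {m m' : RootedMap} {t : Set Word} {lab : m.Dart → DartLabel} {lab' : m'.Dart → DartLabel}
  {f : m.Face} {u : Word}

namespace Coding

theorem mem (h : Coding m t lab) (d : m.Dart) : lab d ∈ labels t := h.bij.mapsTo trivial

theorem injective (h : Coding m t lab) : Function.Injective lab := Set.injOn_univ.1 h.bij.injOn

theorem exists_dart (h : Coding m t lab) {p : DartLabel} (hp : p ∈ labels t) : ∃ d, lab d = p := by
  simpa using h.bij.surjOn hp

theorem origin_eq_iff (h : Coding m t lab) {d d' : m.Dart} :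
    m.origin d = m.origin d' ↔ org (lab d) = org (lab d') :=
  ⟨RootedMap.eq_of_origin_eq (g := fun d => org (lab d)) h.inv, h.vert d d'⟩

theorem faceOf_eq_iff (h : Coding m t lab) {d d' : m.Dart} :
    m.faceOf d = m.faceOf d' ↔ (lab d).1 = (lab d').1 := by
  refine ⟨RootedMap.eq_of_faceOf_eq (g := fun d => (lab d).1) fun d => by rw [h.next]; rfl,
    fun hd => ?_⟩
  have index_eq : ∀ s s' : Fin 3, s' = s ∨ s' = s + 1 ∨ s' = s + 1 + 1 := by decide
  rcases index_eq (lab d).2 (lab d').2 with hs | hs | hs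
  · rw [h.injective (Prod.ext hd hs.symm)]
  · have lab_eq : lab d' = lab (m.next d) := by
      rw [h.next]
      exact Prod.ext hd.symm hs
    rw [h.injective lab_eq, RootedMap.faceOf_next]
  · have lab_eq : lab d' = lab (m.next (m.next d)) := by
      rw [h.next, h.next]
      exact Prod.ext hd.symm hs
    rw [h.injective lab_eq, RootedMap.faceOf_next, RootedMap.faceOf_next]

theorem congr (h : Coding m t lab) {e : m'.Dart ≃ m.Dart} (he : RootedMap.Iso m' m e) :
    Coding m' t (lab ∘ e) where
  bij := h.bij.comp (Set.bijOn_univ.2 e.bijective)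
  next d := by rw [Function.comp_apply, he.2.1, h.next]; rfl
  root := by rw [Function.comp_apply, he.1, he.2.2, h.root]
  inv d := by rw [Function.comp_apply, Function.comp_apply, he.1, he.2.1, h.inv]
  vert _ _ hd := he.origin_eq_iff.1 (h.vert _ _ hd)

theorem org_nxt_lab_inv (h : Coding m t lab) (d : m.Dart) :
    org (nxt (lab (m.inv d))) = org (lab d) := by
  rw [← h.next, ← h.inv, m.inv_inv]

theorem exists_iso (ht : IsTernaryTree t) (h : Coding m t lab) (h' : Coding m' t lab') :
    ∃ e, RootedMap.Iso m m' e ∧ ∀ d, lab' (e d) = lab d := by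
  choose g hg using fun d => h'.exists_dart (h.mem d)
  have bijective : Function.Bijective g := by
    refine ⟨fun a b hab => h.injective (by rw [← hg, hab, hg]), fun d' => ?_⟩
    obtain ⟨d, hd⟩ := h.exists_dart (h'.mem d')
    exact ⟨d, h'.injective ((hg d).trans hd)⟩
  have map_next : ∀ d, g (m.next d) = m'.next (g d) := fun d =>
    h'.injective (by rw [hg, h.next, h'.next, hg])
  have map_inv : ∀ d, g (m.inv d) = m'.inv (g d) := by
    refine fun d => h'.injective (labels_inj ht (h'.mem _) (h'.mem _) ?_ ?_)
    · rw [hg, h.inv, h'.inv, h.next, h'.next, hg]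
    · rw [hg, h.org_nxt_lab_inv, h'.org_nxt_lab_inv, hg]
  have map_root : g m.root = m'.root := by
    refine m'.inv.injective (h'.injective ?_)
    rw [← map_inv, hg, h.root, h'.root]
  exact ⟨Equiv.ofBijective g bijective, ⟨map_inv, map_next, map_root⟩, hg⟩

theorem ne_outerFace_iff (h : Coding m t lab) {d : m.Dart} :
    m.faceOf d ≠ m.outerFace ↔ ∃ u, (lab d).1 = some u := by
  rw [← Option.ne_none_iff_exists', RootedMap.outerFace, Ne, Ne, h.faceOf_eq_iff, h.root]

theorem exists_finiteFace (h : Coding m t lab) (hu : u ∈ leaves t) :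
    ∃ f ∈ m.finiteFaces, HasFaceLabel lab f u := by
  obtain ⟨d₀, hd₀⟩ := h.exists_dart (some_mem_labels (s := 0).2 hu)
  refine ⟨m.faceOf d₀, h.ne_outerFace_iff.2 ⟨u, by rw [hd₀]⟩, fun d => ?_⟩
  rw [h.faceOf_eq_iff, hd₀]

theorem exists_hasFaceLabel (h : Coding m t lab) (hf : f ∈ m.finiteFaces) :
    ∃ u ∈ leaves t, HasFaceLabel lab f u := by
  obtain ⟨d₀, rfl⟩ := RootedMap.faceOf_surjective f
  obtain ⟨u, hu⟩ := h.ne_outerFace_iff.1 hf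
  exact ⟨u, h.mem d₀ u hu, fun d => by rw [h.faceOf_eq_iff, hu]⟩

end Coding

/-! ### The triangle -/

/-- The labels of the darts of the triangle. -/
def triangleLab (d : Fin 3 × Bool) : DartLabel :=
  if d.2 then (some [], d.1) else (none, -(d.1 + 1))

theorem org_triangleLab (d : Fin 3 × Bool) :
    org (triangleLab d) = .inr (if d.2 then d.1 else d.1 + 1) := by
  obtain ⟨i, _ | _⟩ := d <;> simp [triangleLab, org]

theorem bijOn_triangleLab : Set.BijOn triangleLab Set.univ (labels {[]}) := by
  have nil_mem_leaves : ([] : Word) ∈ leaves {[]} := mem_leaves_iff.2 (by simp)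
  refine ⟨?_, ?_, ?_⟩
  · rintro ⟨i, _ | _⟩ -
    exacts [none_mem_labels, some_mem_labels.2 nil_mem_leaves]
  · refine Function.Injective.injOn fun d d' => ?_
    obtain ⟨i, _ | _⟩ := d <;> obtain ⟨j, _ | _⟩ := d' <;> simp [triangleLab]
  · rintro ⟨_ | u, s⟩ h
    · exact ⟨(-s - 1, false), trivial, by simp [triangleLab]⟩
    · obtain rfl : u = [] := (h u rfl).1
      exact ⟨(s, true), trivial, rfl⟩

theorem origin_triangle (d : Fin 3 × Bool) : RootedMap.triangle.origin d =
    RootedMap.triangle.origin ((if d.2 then d.1 else d.1 + 1, true) : Fin 3 × Bool) := by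
  obtain ⟨i, _ | _⟩ := d
  · exact RootedMap.origin_inv (m := RootedMap.triangle) (i, true)
  · rfl

theorem Coding.triangle : Coding RootedMap.triangle {[]} triangleLab where
  bij := bijOn_triangleLab
  next := by
    rintro ⟨i, _ | _⟩
    exacts [Prod.ext rfl (show -(i - 1 + 1) = -(i + 1) + 1 by abel), rfl]
  root := rfl
  inv := by
    rintro ⟨i, _ | _⟩ <;> refine (org_triangleLab _).trans (.trans ?_ (org_triangleLab _).symm)
    exacts [congrArg Sum.inr (sub_add_cancel i 1).symm, rfl]
  vert d d' h := by
    have endpoint_eq := Sum.inr.inj ((org_triangleLab d).symm.trans (h.trans (org_triangleLab d')))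
    exact (origin_triangle d).trans (.trans (by rw [endpoint_eq]) (origin_triangle d').symm)

end

/-! ### Insertion of a vertex -/

section

/-- The labels of the three darts of `RootedMap.sideDart` when a vertex is inserted in the triangle
`u`, the side being the one that starts at the corner `s`. -/
def sideLabel (u : Word) (s : Fin 3) : Option Bool → DartLabel
  | none => (some (u ++ [letter (s + 2)]), s)
  | some true => (some (u ++ [letter (s + 2)]), s + 2)
  | some false => (some (u ++ [letter (s + 1)]), s)

open Classical in
/-- The labels of the darts after the insertion of a vertex in the face `f` with label `u`. -/
noncomputable def insertLab {m : RootedMap} (lab : m.Dart → DartLabel) (f : m.Face) (u : Word) :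
    m.InsertDart f → DartLabel
  | .inl d => if m.faceOf d = f then sideLabel u (lab d).2 none else lab d
  | .inr (d, b) => sideLabel u (lab d).2 (some b)

variable {m : RootedMap} {t : Set Word} {lab : m.Dart → DartLabel} {f : m.Face} {u : Word}

theorem sideLabel_inj {s s' : Fin 3} {o o' : Option Bool} :
    sideLabel u s o = sideLabel u s' o' ↔ s = s' ∧ o = o' := by
  rcases o with _ | _ | _ <;> rcases o' with _ | _ | _ <;>
    simp only [sideLabel, Prod.mk.injEq, Option.some.injEq, List.append_cancel_left_eq,
      List.cons.injEq, letter_inj, and_true] <;>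
    revert s s' <;> decide

theorem exists_sideLabel_eq (r s : Fin 3) :
    ∃ s' o, sideLabel u s' o = (some (u ++ [letter r]), s) := by
  obtain rfl | rfl | rfl : r = s + 2 ∨ r = s + 1 ∨ s = r + 1 + 2 := by revert r s; decide
  · exact ⟨s, none, rfl⟩
  · exact ⟨s, some false, rfl⟩
  · exact ⟨r + 1, some true, by simp [sideLabel, add_assoc]⟩

theorem sideLabel_fst (s : Fin 3) (o : Option Bool) :
    ∃ r, (sideLabel u s o).1 = some (u ++ [letter r]) := by
  rcases o with _ | _ | _ <;> exact ⟨_, rfl⟩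

theorem mem_labels_growTree_iff (ht : IsTernaryTree t) (hu : u ∈ leaves t) {p : DartLabel} :
    p ∈ labels (growTree t u) ↔ (p ∈ labels t ∧ p.1 ≠ some u) ∨ ∃ s o, sideLabel u s o = p := by
  constructor
  · obtain ⟨_ | v, s⟩ := p
    · exact fun _ => .inl ⟨none_mem_labels, by simp⟩
    · rw [some_mem_labels, some_mem_labels, ht.mem_leaves_growTree_iff hu]
      rintro (⟨hv, hvu⟩ | ⟨r, rfl⟩)
      exacts [.inl ⟨hv, by simpa using hvu⟩, .inr (exists_sideLabel_eq r s)]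
  · rintro (⟨hp, hpu⟩ | ⟨s, o, rfl⟩) v hv <;> rw [ht.mem_leaves_growTree_iff hu]
    · exact .inl ⟨hp v hv, fun hvu => hpu (hvu ▸ hv)⟩
    · obtain ⟨r, hr⟩ := sideLabel_fst (u := u) s o
      exact .inr ⟨r, Option.some.inj (hv.symm.trans hr)⟩

theorem sideLabel_notMem_labels (hu : u ∈ leaves t) (s : Fin 3) (o : Option Bool) :
    sideLabel u s o ∉ labels t := fun h => by
  obtain ⟨r, hr⟩ := sideLabel_fst (u := u) s o
  exact (mem_leaves_iff.1 hu).2 _ (h _ hr).1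

theorem org_ne_of_mem_leaves (ht : IsTernaryTree t) (hu : u ∈ leaves t) {p : DartLabel}
    (hp : p ∈ labels t) : org p ≠ .inl u := by
  obtain ⟨_ | v, s⟩ := p
  · simp [org]
  · exact fun h => notMem_leaves_of_mem_internalNodes
      (ht.mem_internalNodes_of_corner (some_mem_labels.1 hp).1 h) hu

theorem insertLab_inl_of_ne {d : m.Dart} (hd : m.faceOf d ≠ f) :
    insertLab lab f u (.inl d) = lab d := if_neg hd

theorem insertLab_sideDart (d : {d : m.Dart // m.faceOf d = f}) (o : Option Bool) :
    insertLab lab f u (RootedMap.sideDart d o) = sideLabel u (lab d).2 o := by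
  rcases o with _ | b
  exacts [if_pos d.2, rfl]

namespace HasFaceLabel

theorem lab_eq (hf : HasFaceLabel lab f u) (d : {d : m.Dart // m.faceOf d = f}) :
    lab d = (some u, (lab d).2) := Prod.ext ((hf d).1 d.2) rfl

theorem org_insertLab_inl (hf : HasFaceLabel lab f u) (d : m.Dart) :
    org (insertLab lab f u (.inl d)) = org (lab d) := by
  by_cases hd : m.faceOf d = f
  · refine (congrArg org (insertLab_sideDart ⟨d, hd⟩ none)).trans ?_
    rw [hf.lab_eq ⟨d, hd⟩]
    exact corner_snoc_of_ne _ (by simp)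
  · rw [insertLab_inl_of_ne hd]

theorem org_insertLab_false (hf : HasFaceLabel lab f u) (d : {d : m.Dart // m.faceOf d = f}) :
    org (insertLab lab f u (.inr (d, false))) = org (lab d) := by
  rw [hf.lab_eq]
  exact corner_snoc_of_ne _ (by simp)

end HasFaceLabel

theorem org_insertLab_true (d : {d : m.Dart // m.faceOf d = f}) :
    org (insertLab lab f u (.inr (d, true))) = .inl u := corner_snoc_self _ _

namespace Coding

theorem lab_next_symm (h : Coding m t lab) (d : m.Dart) :
    (lab (m.next.symm d)).2 = (lab d).2 + 2 := by
  have next_symm := h.next (m.next.symm d)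
  rw [Equiv.apply_symm_apply] at next_symm
  rw [next_symm, nxt, add_assoc]
  exact (add_zero _).symm

theorem injective_insertLab (h : Coding m t lab) (hu : u ∈ leaves t) (hf : HasFaceLabel lab f u) :
    Function.Injective (insertLab lab f u) := by
  intro x y hxy
  obtain ⟨d, hd, rfl⟩ | ⟨d, o, rfl⟩ := RootedMap.exists_eq_sideDart x <;>
    obtain ⟨d', hd', rfl⟩ | ⟨d', o', rfl⟩ := RootedMap.exists_eq_sideDart y
  · rw [insertLab_inl_of_ne hd, insertLab_inl_of_ne hd'] at hxy
    rw [h.injective hxy]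
  · rw [insertLab_inl_of_ne hd, insertLab_sideDart] at hxy
    exact absurd (hxy ▸ h.mem d) (sideLabel_notMem_labels hu _ _)
  · rw [insertLab_inl_of_ne hd', insertLab_sideDart] at hxy
    exact absurd (hxy ▸ h.mem d') (sideLabel_notMem_labels hu _ _)
  · rw [insertLab_sideDart, insertLab_sideDart, sideLabel_inj] at hxy
    obtain ⟨hd, rfl⟩ := hxy
    rw [Subtype.ext (h.injective (by rw [hf.lab_eq d, hf.lab_eq d', hd]) : d.1 = d'.1)]

theorem bijOn_insertLab (ht : IsTernaryTree t) (hu : u ∈ leaves t) (h : Coding m t lab)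
    (hf : HasFaceLabel lab f u) :
    Set.BijOn (insertLab lab f u) Set.univ (labels (growTree t u)) := by
  refine ⟨fun x _ => ?_, (h.injective_insertLab hu hf).injOn, fun p hp => ?_⟩
  · rw [mem_labels_growTree_iff ht hu]
    obtain ⟨d, hd, rfl⟩ | ⟨d, o, rfl⟩ := RootedMap.exists_eq_sideDart x
    · rw [insertLab_inl_of_ne hd]
      exact .inl ⟨h.mem d, fun hlab => hd ((hf d).2 hlab)⟩
    · exact .inr ⟨_, o, (insertLab_sideDart d o).symm⟩
  · obtain ⟨hp, hpu⟩ | ⟨s, o, rfl⟩ := (mem_labels_growTree_iff ht hu).1 hp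
    · obtain ⟨d, rfl⟩ := h.exists_dart hp
      exact ⟨.inl d, trivial, insertLab_inl_of_ne fun hd => hpu ((hf d).1 hd)⟩
    · obtain ⟨d, hd⟩ := h.exists_dart (some_mem_labels (s := s).2 hu)
      refine ⟨RootedMap.sideDart ⟨d, (hf d).2 (by rw [hd])⟩ o, trivial, ?_⟩
      rw [insertLab_sideDart, hd]

theorem insertLab_next (h : Coding m t lab) (x : m.InsertDart f) :
    insertLab lab f u ((m.insert f).next x) = nxt (insertLab lab f u x) := by
  obtain ⟨d, hd, rfl⟩ | ⟨d, o, rfl⟩ := RootedMap.exists_eq_sideDart x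
  · rw [RootedMap.insert_next_inl_of_ne hd, insertLab_inl_of_ne hd,
      insertLab_inl_of_ne (by rwa [RootedMap.faceOf_next]), h.next]
  · rw [insertLab_sideDart]
    rcases o with _ | _ | _
    · refine (congrArg _ (RootedMap.insert_next_inl_of_eq d)).trans ?_
      simp only [insertLab, h.next, sideLabel, nxt, add_assoc]
      rfl
    · change sideLabel u (lab (m.next.symm d)).2 (some true) = _
      simp only [h.lab_next_symm, sideLabel, nxt, add_assoc]
      rfl
    · refine (insertLab_sideDart d none).trans ?_
      simp only [sideLabel, nxt, add_assoc]
      exact Prod.ext rfl (add_zero _).symm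

theorem org_insertLab_inv (h : Coding m t lab) (hf : HasFaceLabel lab f u) (x : m.InsertDart f) :
    org (insertLab lab f u ((m.insert f).inv x)) =
      org (insertLab lab f u ((m.insert f).next x)) := by
  obtain d | ⟨d, _ | _⟩ := x
  · refine (hf.org_insertLab_inl (m.inv d)).trans ((h.inv d).trans ?_)
    by_cases hd : m.faceOf d = f
    · rw [RootedMap.insert_next_inl_of_eq ⟨d, hd⟩]
      exact (hf.org_insertLab_false ⟨m.next d, _⟩).symm
    · rw [RootedMap.insert_next_inl_of_ne hd, hf.org_insertLab_inl]
  · exact (org_insertLab_true d).trans (org_insertLab_true _).symm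
  · exact (hf.org_insertLab_false d).trans (hf.org_insertLab_inl d).symm

theorem insert_origin_eq (ht : IsTernaryTree t) (hu : u ∈ leaves t) (h : Coding m t lab)
    (hf : HasFaceLabel lab f u) {x y : m.InsertDart f}
    (hxy : org (insertLab lab f u x) = org (insertLab lab f u y)) :
    (m.insert f).origin x = (m.insert f).origin y := by
  have old_or_new : ∀ x : m.InsertDart f, (∃ d, (m.insert f).origin x = (m.insert f).origin (.inl d)
      ∧ org (insertLab lab f u x) = org (lab d)) ∨ ∃ d, x = .inr (d, true) := by
    rintro (d | ⟨d, _ | _⟩)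
    exacts [.inl ⟨d, rfl, hf.org_insertLab_inl d⟩,
      .inl ⟨d, RootedMap.insert_origin_false d, hf.org_insertLab_false d⟩, .inr ⟨d, rfl⟩]
  have org_ne := fun d => org_ne_of_mem_leaves ht hu (h.mem d)
  obtain ⟨d, hx, hd⟩ | ⟨d, rfl⟩ := old_or_new x <;> obtain ⟨d', hy, hd'⟩ | ⟨d', rfl⟩ := old_or_new y
  · rw [hd, hd'] at hxy
    rw [hx, hy, RootedMap.insert_origin_inl (h.vert _ _ hxy)]
  · rw [hd, org_insertLab_true] at hxy
    exact absurd hxy (org_ne d)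
  · rw [hd', org_insertLab_true] at hxy
    exact absurd hxy.symm (org_ne d')
  · exact RootedMap.insert_origin_true d d'

theorem insert (ht : IsTernaryTree t) (hu : u ∈ leaves t) (h : Coding m t lab)
    (hf : HasFaceLabel lab f u) : Coding (m.insert f) (growTree t u) (insertLab lab f u) where
  bij := h.bijOn_insertLab ht hu hf
  next := h.insertLab_next
  root := by
    refine (insertLab_inl_of_ne fun hroot => ?_).trans h.root
    simpa [h.root] using (hf _).1 hroot
  inv := h.org_insertLab_inv hf
  vert _ _ := h.insert_origin_eq ht hu hf

end Coding

end

/-! ### Uniqueness of the coding -/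

section

variable {m : RootedMap} {t t' : Set Word} {lab lab' : m.Dart → DartLabel} {w w' : Word}

namespace IsTernaryTree

theorem eq_nil_or_exists_eq_snoc (ht : IsTernaryTree t) (hw : w ∈ t) :
    w = [] ∨ ∃ x ∈ internalNodes t, ∃ s, w = x ++ [letter s] := by
  rcases w.eq_nil_or_concat' with rfl | ⟨x, a, rfl⟩
  · exact .inl rfl
  · obtain ⟨s, rfl⟩ := ht.exists_letter_eq hw
    exact .inr ⟨x, ht.mem_internalNodes_of_append_cons_mem hw, s, rfl⟩

theorem mem_iff_eq_nil_or_exists_eq_snoc (ht : IsTernaryTree t) :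
    w ∈ t ↔ w = [] ∨ ∃ x ∈ internalNodes t, ∃ s, w = x ++ [letter s] := by
  refine ⟨ht.eq_nil_or_exists_eq_snoc, ?_⟩
  rintro (rfl | ⟨x, hx, s, rfl⟩)
  exacts [ht.root_mem, ht.snoc_letter_mem hx s]

theorem eq_of_internalNodes_eq (ht : IsTernaryTree t) (ht' : IsTernaryTree t')
    (h : internalNodes t = internalNodes t') : t = t' := by
  ext w
  rw [ht.mem_iff_eq_nil_or_exists_eq_snoc, ht'.mem_iff_eq_nil_or_exists_eq_snoc, h]

theorem length_le_of_forall_exists_corner_eq (ht : IsTernaryTree t) (hw : w ∈ t)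
    (h : ∀ s, ∃ r, corner w s = corner w' r) : w.length ≤ w'.length := by
  rcases ht.eq_nil_or_exists_eq_snoc hw with rfl | ⟨x, -, s, rfl⟩
  · exact Nat.zero_le _
  · obtain ⟨r, hr⟩ := h s
    rw [corner_snoc_self] at hr
    simpa using length_lt_of_corner_eq_inl hr.symm

/-- The longest label of a corner of a triangle is that of its parent, which determines the triangle
up to its last letter; this letter is the number of the only corner missing from the triangle. -/
theorem eq_of_forall_exists_corner_eq (ht : IsTernaryTree t) (ht' : IsTernaryTree t') (hw : w ∈ t)
    (hw' : w' ∈ t') (h : ∀ s, ∃ r, corner w s = corner w' r) : w = w' := by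
  have length_eq : w.length = w'.length := by
    choose σ hσ using h
    have surjective : Function.Surjective σ := Finite.surjective_of_injective fun s s' hs =>
      corner_injective w (by rw [hσ, hσ, hs])
    refine (ht.length_le_of_forall_exists_corner_eq hw fun s => ⟨σ s, hσ s⟩).antisymm
      (ht'.length_le_of_forall_exists_corner_eq hw' fun r => ?_)
    obtain ⟨s, rfl⟩ := surjective r
    exact ⟨s, (hσ s).symm⟩
  rcases ht.eq_nil_or_exists_eq_snoc hw with rfl | ⟨x, -, s, rfl⟩
  · exact (List.length_eq_zero_iff.1 length_eq.symm).symm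
  obtain ⟨r, hr⟩ := h s
  rw [corner_snoc_self] at hr
  obtain ⟨_ | _, rfl, -⟩ := corner_eq_inl_iff.1 hr.symm
  · by_contra hne
    have hsr : letter s ≠ letter r := fun hsr => hne (by rw [hsr])
    obtain ⟨q, hq⟩ := h r
    rw [corner_snoc_of_ne _ hsr, corner_snoc] at hq
    split_ifs at hq with hrq
    · exact (length_lt_of_corner_eq_inl hq).false
    · exact hrq (by rw [corner_injective x hq])
  · simp at length_eq

end IsTernaryTree

theorem corner_eq_or_corner_eq (u : Word) {s s' : Fin 3} (h : s ≠ s') :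
    (∃ i, corner u s = .inr i) ∨ (∃ y, corner u s = .inl y ∧ corner u s' = corner y s') ∨
      ∃ y, corner u s' = .inl y ∧ corner u s = corner y s := by
  induction u using List.reverseRecOn with
  | nil => exact .inl ⟨s, rfl⟩
  | append_singleton u a ih =>
    by_cases hs : a = letter s
    · subst hs
      exact .inr (.inl ⟨u, corner_snoc_self u s, corner_snoc_of_ne u (mt letter_inj.1 h)⟩)
    by_cases hs' : a = letter s'
    · subst hs'
      exact .inr (.inr ⟨u, corner_snoc_self u s', corner_snoc_of_ne u hs⟩)
    rwa [corner_snoc_of_ne u hs, corner_snoc_of_ne u hs']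

namespace Coding

/-- Every edge off the infinite face joins an internal vertex to a corner of the triangle in which
this vertex was inserted. -/
theorem exists_corner_eq_org_inv (h : Coding m t lab) (d : m.Dart) :
    (∃ i, org (lab d) = .inr i) ∨
      (∃ y s, org (lab d) = .inl y ∧ org (lab (m.inv d)) = corner y s) ∨
      ∃ y s, org (lab (m.inv d)) = .inl y ∧ org (lab d) = corner y s := by
  rw [h.inv, h.next]
  rcases lab d with ⟨_ | u, s⟩
  · exact .inl ⟨_, rfl⟩
  · refine (corner_eq_or_corner_eq u (by simp : s ≠ s + 1)).imp_right
      (.imp ?_ ?_) <;> exact fun ⟨y, hy⟩ => ⟨y, _, hy⟩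

theorem exists_lab_eq_of_org (h : Coding m t lab) {d : m.Dart} (hd : org (lab d) = .inl w) :
    ∃ u ∈ leaves t, ∃ s, lab d = (some u, s) ∧ corner u s = .inl w := by
  have hmem := h.mem d
  generalize lab d = p at hd hmem
  obtain ⟨_ | u, s⟩ := p
  · cases hd
  · exact ⟨u, some_mem_labels.1 hmem, s, rfl, hd⟩

theorem mem_internalNodes_of_org (ht : IsTernaryTree t) (h : Coding m t lab) {d : m.Dart}
    (hd : org (lab d) = .inl w) : w ∈ internalNodes t := by
  obtain ⟨u, hu, s, -, hs⟩ := h.exists_lab_eq_of_org hd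
  exact ht.mem_internalNodes_of_corner hu.1 hs

theorem exists_org_eq_corner (ht : IsTernaryTree t) (h : Coding m t lab) (hw : w ∈ t) (s : Fin 3) :
    ∃ d, org (lab d) = corner w s := by
  obtain ⟨u, hu, hus, -⟩ := ht.exists_leaf_corner_eq hw s s
  obtain ⟨d, hd⟩ := h.exists_dart (some_mem_labels (s := s).2 hu)
  exact ⟨d, by rw [hd]; exact hus⟩

theorem exists_org_inv_eq_corner (ht : IsTernaryTree t) (h : Coding m t lab)
    (hw : w ∈ internalNodes t) (s : Fin 3) :
    ∃ d, org (lab d) = .inl w ∧ org (lab (m.inv d)) = corner w s := by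
  have hne : s - 1 ≠ s := by simp
  obtain ⟨u, hu, hw', hs⟩ := ht.exists_leaf_corner_eq (ht.snoc_letter_mem hw (s - 1)) (s - 1) s
  rw [corner_snoc_self] at hw'
  rw [corner_snoc_of_ne _ (mt letter_inj.1 hne)] at hs
  obtain ⟨d, hd⟩ := h.exists_dart (some_mem_labels (s := s - 1).2 hu)
  refine ⟨d, by rw [hd]; exact hw', ?_⟩
  rw [h.inv, h.next, hd, nxt, sub_add_cancel]
  exact hs

theorem exists_outer_dart (h : Coding m t lab) (h' : Coding m t' lab') (s : Fin 3) :
    ∃ d, lab d = (none, s) ∧ lab' d = (none, s) := by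
  have index_eq : s = 2 ∨ s = 2 + 1 ∨ s = 2 + 1 + 1 := by revert s; decide
  rcases index_eq with rfl | rfl | rfl
  · exact ⟨m.inv m.root, h.root, h'.root⟩
  · exact ⟨m.next (m.inv m.root), by rw [h.next, h.root, nxt], by rw [h'.next, h'.root, nxt]⟩
  · exact ⟨m.next (m.next (m.inv m.root)), by rw [h.next, h.next, h.root, nxt, nxt],
      by rw [h'.next, h'.next, h'.root, nxt, nxt]⟩

theorem org_eq_inr_iff (h : Coding m t lab) (h' : Coding m t' lab') {d : m.Dart} {i : Fin 3} :
    org (lab d) = .inr i ↔ org (lab' d) = .inr i := by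
  obtain ⟨o, ho, ho'⟩ := h.exists_outer_dart h' (-i)
  have org_outer : org (none, -i) = .inr i := by rw [org, neg_neg]
  rw [← org_outer]
  nth_rw 1 [← ho]
  rw [← ho', ← h.origin_eq_iff, ← h'.origin_eq_iff]

theorem org_eq_inl (ht : IsTernaryTree t) (ht' : IsTernaryTree t') (h : Coding m t lab)
    (h' : Coding m t' lab') {d : m.Dart} (hd : org (lab d) = .inl w) : org (lab' d) = .inl w := by
  induction hn : w.length using Nat.strong_induction_on generalizing w d with
  | _ n ih =>
    subst hn
    have org_eq_corner : ∀ {y s d}, y.length ≤ w.length → org (lab d) = corner y s →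
        org (lab' d) = corner y s := fun {y s d} hy hds => by
      cases hys : corner y s with
      | inl x => exact ih _ ((length_lt_of_corner_eq_inl hys).trans_le hy) (hds.trans hys) rfl
      | inr i => exact (h.org_eq_inr_iff h').1 (hds.trans hys)
    have hw := h.mem_internalNodes_of_org ht hd
    have corner_eq : ∀ s, ∃ w', org (lab' d) = .inl w' ∧ ∃ r, corner w s = corner w' r := by
      intro s
      obtain ⟨e, he, hes⟩ := h.exists_org_inv_eq_corner ht hw s
      have hes' := org_eq_corner le_rfl hes
      have hde := h.origin_eq_iff.2 (hd.trans he.symm)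
      rcases h'.exists_corner_eq_org_inv e with ⟨i, hi⟩ | ⟨w', r, hw', hr⟩ | ⟨y, r, hy, hr⟩
      · rw [(h.org_eq_inr_iff h').2 hi] at he
        cases he
      · exact ⟨w', (h'.origin_eq_iff.1 hde).trans hw', r, hes'.symm.trans hr⟩
      · have hyw := length_lt_of_corner_eq_inl (hes'.symm.trans hy)
        obtain ⟨e', he'⟩ := h.exists_org_eq_corner ht
          (h.mem_internalNodes_of_org ht (hes.trans (hes'.symm.trans hy))).1 r
        have hee' := h'.origin_eq_iff.2 (hr.trans (org_eq_corner hyw.le he').symm)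
        rw [h.origin_eq_iff, he, he'] at hee'
        exact absurd (length_lt_of_corner_eq_inl hee'.symm) hyw.not_gt
    obtain ⟨w', hw', -⟩ := corner_eq 0
    suffices w = w' by rw [hw', this]
    refine ht.eq_of_forall_exists_corner_eq ht' hw.1 (h'.mem_internalNodes_of_org ht' hw').1
      fun s => ?_
    obtain ⟨x, hx, hs⟩ := corner_eq s
    rwa [Sum.inl.inj (hx.symm.trans hw')] at hs

theorem org_eq (ht : IsTernaryTree t) (ht' : IsTernaryTree t') (h : Coding m t lab)
    (h' : Coding m t' lab') (d : m.Dart) : org (lab d) = org (lab' d) := by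
  cases hd : org (lab d) with
  | inl w => exact (h.org_eq_inl ht ht' h' hd).symm
  | inr i => exact ((h.org_eq_inr_iff h').1 hd).symm

theorem mem_internalNodes_iff (ht : IsTernaryTree t) (h : Coding m t lab) :
    w ∈ internalNodes t ↔ ∃ d, org (lab d) = .inl w := by
  refine ⟨fun hw => ?_, fun ⟨d, hd⟩ => h.mem_internalNodes_of_org ht hd⟩
  obtain ⟨d, hd, -⟩ := h.exists_org_inv_eq_corner ht hw 0
  exact ⟨d, hd⟩

theorem tree_unique (ht : IsTernaryTree t) (ht' : IsTernaryTree t') (h : Coding m t lab)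
    (h' : Coding m t' lab') : t = t' := by
  refine ht.eq_of_internalNodes_eq ht' (Set.ext fun w => ?_)
  simp_rw [h.mem_internalNodes_iff ht, h'.mem_internalNodes_iff ht', h.org_eq ht ht' h']

theorem lab_unique (ht : IsTernaryTree t) (h : Coding m t lab) (h' : Coding m t lab') :
    lab = lab' := by
  refine funext fun d => labels_inj ht (h.mem d) (h'.mem d) (h.org_eq ht ht h' d) ?_
  rw [← h.next, ← h'.next, h.org_eq ht ht h']

end Coding

end

/-! ### Degrees -/

section

variable {m : RootedMap} {t : Set Word} {lab : m.Dart → DartLabel} {u v w : Word}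

/-- The words coding the triangles having the vertex inserted in `w` as a corner. -/
def incident (w : Word) : Set Word := {v | ∃ s, corner v s = .inl w}

theorem self_notMem_incident : w ∉ incident w := fun ⟨_, hs⟩ =>
  (length_lt_of_corner_eq_inl hs).false

theorem snoc_mem_incident_iff {r : Fin 3} :
    u ++ [letter r] ∈ incident w ↔ u = w ∨ ∃ s ≠ r, corner u s = .inl w := by
  constructor
  · rintro ⟨s, hs⟩
    rw [corner_snoc] at hs
    split_ifs at hs with hr
    · exact .inl (Sum.inl.inj hs)
    · exact .inr ⟨s, fun h => hr (by rw [h]), hs⟩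
  · rintro (rfl | ⟨s, hr, hs⟩)
    · exact ⟨r, corner_snoc_self u r⟩
    · exact ⟨s, by rwa [corner_snoc_of_ne _ (mt letter_inj.1 hr.symm)]⟩

theorem mem_startThen_iff {s : Fin 3} {y : Word} :
    letter s :: y ∈ startThen 1 2 3 ∪ startThen 2 1 3 ∪ startThen 3 1 2 ↔
      ∀ a ∈ y, ∃ r ≠ s, letter r = a := by
  fin_cases s <;> simp [startThen, letter, Fin.exists_fin_succ, eq_comm]

theorem exists_eq_letter_cons {x : Word}
    (hx : x ∈ startThen 1 2 3 ∪ startThen 2 1 3 ∪ startThen 3 1 2) : ∃ s y, x = letter s :: y := by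
  rcases hx with (⟨y, rfl, -⟩ | ⟨y, rfl, -⟩) | ⟨y, rfl, -⟩
  exacts [⟨0, y, rfl⟩, ⟨1, y, rfl⟩, ⟨2, y, rfl⟩]

namespace IsTernaryTree

theorem binaryForest_internalNodes (ht : IsTernaryTree t) :
    binaryForest (internalNodes t) w = internalNodes t ∩ incident w := by
  refine Set.ext fun v => and_congr_right fun hv => ⟨?_, ?_⟩
  · rintro ⟨x, hx, rfl⟩
    obtain ⟨s, y, rfl⟩ := exists_eq_letter_cons hx
    refine ⟨s, corner_append_cons _ _ _ fun hs => ?_⟩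
    obtain ⟨r, hr, hrs⟩ := mem_startThen_iff.1 hx _ hs
    exact hr (letter_inj.1 hrs)
  · rintro ⟨s, hs⟩
    obtain ⟨y, rfl, hy⟩ := corner_eq_inl_iff.1 hs
    refine ⟨_, mem_startThen_iff.2 fun a ha => ?_, rfl⟩
    obtain ⟨r, rfl⟩ := ht.exists_letter_eq_of_mem hv.1 (a := a) (by simp [ha])
    exact ⟨r, fun hr => hy (hr ▸ ha), rfl⟩

theorem notMem_incident (ht : IsTernaryTree t) (hw : w ∈ leaves t) (hv : v ∈ t) :
    v ∉ incident w := fun ⟨_, hs⟩ =>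
  notMem_leaves_of_mem_internalNodes (ht.mem_internalNodes_of_corner hv hs) hw

theorem leaves_growTree (ht : IsTernaryTree t) (hu : u ∈ leaves t) :
    leaves (_root_.growTree t u) = leaves t \ {u} ∪ Set.range fun s => u ++ [letter s] := by
  ext v
  simp [ht.mem_leaves_growTree_iff hu, eq_comm]

theorem ncard_leaves_growTree_inter_incident_self (ht : IsTernaryTree t) (hu : u ∈ leaves t) :
    (leaves (_root_.growTree t u) ∩ incident u).ncard = 3 := by
  have inter_eq : leaves (_root_.growTree t u) ∩ incident u =
      Set.range fun s => u ++ [letter s] := by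
    rw [ht.leaves_growTree hu, Set.union_inter_distrib_right,
      (Set.disjoint_left.2 fun v hv => ht.notMem_incident hu hv.1.1).inter_eq, Set.empty_union,
      Set.inter_eq_left]
    rintro _ ⟨s, rfl⟩
    exact snoc_mem_incident_iff.2 (.inl rfl)
  rw [inter_eq, ← Set.image_univ, Set.ncard_image_of_injective _ fun s s' h => by simpa using h,
    Set.ncard_univ, Nat.card_fin]

theorem ncard_leaves_growTree_inter_incident (ht : IsTernaryTree t) (hu : u ∈ leaves t)
    (hw : u ∈ incident w) : (leaves (_root_.growTree t u) ∩ incident w).ncard =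
      (leaves t ∩ incident w).ncard + 1 := by
  have ne : u ≠ w := fun h => self_notMem_incident (h ▸ hw)
  have finite : (leaves t ∩ incident w).Finite := ht.finite.subset fun v hv => hv.1.1
  obtain ⟨s, hs⟩ := hw
  have range_inter : (Set.range fun r => u ++ [letter r]) ∩ incident w =
      (fun r => u ++ [letter r]) '' {s}ᶜ := by
    ext v
    constructor
    · rintro ⟨⟨r, rfl⟩, hr⟩
      obtain ⟨s', hr, hs'⟩ := (snoc_mem_incident_iff.1 hr).resolve_left ne
      exact ⟨r, corner_injective u (hs'.trans hs.symm) ▸ hr.symm, rfl⟩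
    · rintro ⟨r, hr, rfl⟩
      exact ⟨⟨r, rfl⟩, snoc_mem_incident_iff.2 (.inr ⟨s, Ne.symm hr, hs⟩)⟩
  have disjoint : Disjoint ((leaves t ∩ incident w) \ {u})
      ((fun r => u ++ [letter r]) '' {s}ᶜ) := by
    rw [Set.disjoint_right]
    rintro _ ⟨r, -, rfl⟩ h
    exact (mem_leaves_iff.1 hu).2 _ h.1.1.1
  rw [ht.leaves_growTree hu, Set.union_inter_distrib_right, range_inter, Set.sdiff_inter_right_comm,
    Set.ncard_union_eq disjoint (finite.subset Set.sdiff_subset) (Set.toFinite _),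
    Set.ncard_image_of_injective _ fun s s' h => by simpa using h, Set.ncard_compl, Nat.card_fin,
    Set.ncard_singleton, ← Set.ncard_sdiff_singleton_add_one
      (show u ∈ leaves t ∩ incident w from ⟨hu, s, hs⟩) finite]

theorem leaves_growTree_inter_incident_of_notMem (ht : IsTernaryTree t) (hu : u ∈ leaves t)
    (hne : u ≠ w) (hw : u ∉ incident w) :
    leaves (_root_.growTree t u) ∩ incident w = leaves t ∩ incident w := by
  have range_inter : (Set.range fun r => u ++ [letter r]) ∩ incident w = ∅ := by
    rw [← Set.disjoint_iff_inter_eq_empty, Set.disjoint_left]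
    rintro _ ⟨r, rfl⟩ hr
    obtain ⟨s, -, hs⟩ := (snoc_mem_incident_iff.1 hr).resolve_left hne
    exact hw ⟨s, hs⟩
  rw [ht.leaves_growTree hu, Set.union_inter_distrib_right, range_inter, Set.union_empty,
    Set.sdiff_inter_right_comm, Set.sdiff_singleton_eq_self fun h => hw h.2]

theorem ncard_leaves_inter_incident (ht : IsTernaryTree t) (hw : w ∈ internalNodes t) :
    (leaves t ∩ incident w).ncard = 3 + (internalNodes t ∩ incident w).ncard := by
  refine ht.induction (P := fun t => w ∈ internalNodes t →
    (leaves t ∩ incident w).ncard = 3 + (internalNodes t ∩ incident w).ncard) ?_ ?_ hw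
  · simp [mem_internalNodes_iff]
  · intro t u ht hu ih hw
    rw [ht.internalNodes_growTree hu] at hw ⊢
    have finite : (internalNodes t ∩ incident w).Finite := ht.finite.subset fun v hv => hv.1.1
    rcases eq_or_ne u w with rfl | hne
    · rw [ht.ncard_leaves_growTree_inter_incident_self hu, Set.insert_inter_of_notMem
        self_notMem_incident, (Set.disjoint_left.2 fun v hv => ht.notMem_incident hu hv.1).inter_eq,
        Set.ncard_empty]
    specialize ih (hw.resolve_left hne.symm)
    by_cases hu' : u ∈ incident w
    · rw [ht.ncard_leaves_growTree_inter_incident hu hu', ih, Set.insert_inter_of_mem hu',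
        Set.ncard_insert_of_notMem
          (fun h => notMem_leaves_of_mem_internalNodes h.1 hu) finite, add_assoc]
    · rw [ht.leaves_growTree_inter_incident_of_notMem hu hne hu', ih,
        Set.insert_inter_of_notMem hu']

end IsTernaryTree

theorem Coding.degree_eq (ht : IsTernaryTree t) (h : Coding m t lab) {d : m.Dart}
    (hd : org (lab d) = .inl w) :
    m.degree (m.origin d) = 3 + (binaryForest (internalNodes t) w).ncard := by
  rw [ht.binaryForest_internalNodes,
    ← ht.ncard_leaves_inter_incident (h.mem_internalNodes_of_org ht hd),
    ← Set.ncard_image_of_injective _ (Option.some_injective _)]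
  refine Set.BijOn.ncard_eq (f := fun e => (lab e).1) (s := {e | m.origin e = m.origin d})
    ⟨fun e he => ?_, fun e he e' he' hee' => ?_, ?_⟩
  · obtain ⟨u, hu, s, hes, hs⟩ := h.exists_lab_eq_of_org ((h.origin_eq_iff.1 he).trans hd)
    exact ⟨u, ⟨hu, s, hs⟩, (congrArg Prod.fst hes).symm⟩
  · obtain ⟨u, -, s, hes, hs⟩ := h.exists_lab_eq_of_org ((h.origin_eq_iff.1 he).trans hd)
    obtain ⟨u', -, s', hes', hs'⟩ := h.exists_lab_eq_of_org ((h.origin_eq_iff.1 he').trans hd)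
    obtain rfl : u = u' := by simpa [hes, hes'] using hee'
    exact h.injective (by rw [hes, hes', corner_injective u (hs.trans hs'.symm)])
  · rintro _ ⟨u, ⟨hu, s, hs⟩, rfl⟩
    obtain ⟨e, he⟩ := h.exists_dart (some_mem_labels (s := s).2 hu)
    exact ⟨e, h.vert _ _ (by rw [hd, he]; exact hs), congrArg Prod.fst he⟩

end

/-! ### The passage function as a distance -/

section

/-- The distances from a point to the corners of the triangle obtained by letting the new vertex
replace the corner designated by `a`, when the original corners are at distances `c`: every path
to the new vertex goes through one of these corners. -/
noncomputable def stepDist (c : Fin 3 → ℕ) (a : ℕ) (s : Fin 3) : ℕ :=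
  if a = letter s then (⨅ r, c r) + 1 else c s

/-- The distances from a point to the corners of the triangle coded by a word, when the corners of
the initial triangle are at distances `c`. -/
noncomputable def cornerDist (c : Fin 3 → ℕ) (u : Word) : Fin 3 → ℕ := u.foldl stepDist c

/-- The distance from a point to the vertex inserted in the triangle coded by a word, when the
corners of the initial triangle are at distances `c`. -/
noncomputable def nodeDist (c : Fin 3 → ℕ) (u : Word) : ℕ := (⨅ s, cornerDist c u s) + 1

variable {c c' : Fin 3 → ℕ} {u : Word} {a b j T : ℕ}

theorem cornerDist_snoc (c : Fin 3 → ℕ) (u : Word) (a : ℕ) :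
    cornerDist c (u ++ [a]) = stepDist (cornerDist c u) a := by
  simp [cornerDist]

theorem iInf_add_one (c : Fin 3 → ℕ) : ⨅ s, (c s + 1) = (⨅ s, c s) + 1 := by
  obtain ⟨r, hr⟩ := exists_eq_ciInf_of_finite (f := c)
  refine le_antisymm ?_ (le_ciInf fun s => Nat.succ_le_succ (ciInf_le' c s))
  exact hr ▸ ciInf_le' (fun s => c s + 1) r

theorem iInf_le_stepDist (c : Fin 3 → ℕ) (a : ℕ) (s : Fin 3) : ⨅ r, c r ≤ stepDist c a s := by
  unfold stepDist
  split_ifs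
  · exact Nat.le_succ _
  · exact ciInf_le' c s

theorem stepDist_mono (h : c ≤ c') (a : ℕ) : stepDist c a ≤ stepDist c' a := by
  intro s
  unfold stepDist
  split_ifs
  · exact Nat.succ_le_succ (ciInf_mono (OrderBot.bddBelow _) h)
  · exact h s

theorem cornerDist_mono (h : c ≤ c') (u : Word) : cornerDist c u ≤ cornerDist c' u := by
  induction u using List.reverseRecOn with
  | nil => exact h
  | append_singleton u a ih =>
    rw [cornerDist_snoc, cornerDist_snoc]
    exact stepDist_mono ih a

theorem nodeDist_mono (h : c ≤ c') (u : Word) : nodeDist c u ≤ nodeDist c' u :=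
  Nat.succ_le_succ (ciInf_mono (OrderBot.bddBelow _) (cornerDist_mono h u))

theorem cornerDist_add_one (c : Fin 3 → ℕ) (u : Word) :
    cornerDist (fun s => c s + 1) u = fun s => cornerDist c u s + 1 := by
  induction u using List.reverseRecOn with
  | nil => rfl
  | append_singleton u a ih =>
    rw [cornerDist_snoc, cornerDist_snoc, ih]
    funext s
    unfold stepDist
    rw [iInf_add_one]
    split_ifs <;> rfl

theorem nodeDist_add_one (c : Fin 3 → ℕ) (u : Word) :
    nodeDist (fun s => c s + 1) u = nodeDist c u + 1 := by
  rw [nodeDist, nodeDist, cornerDist_add_one, iInf_add_one]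

theorem cornerDist_le_iInf_add_one (h : ∀ s, c s ≤ (⨅ r, c r) + 1) (u : Word) (s : Fin 3) :
    cornerDist c u s ≤ (⨅ r, cornerDist c u r) + 1 := by
  induction u using List.reverseRecOn generalizing s with
  | nil => exact h s
  | append_singleton u a ih =>
    rw [cornerDist_snoc]
    have hle : ⨅ r, cornerDist c u r ≤ ⨅ r, stepDist (cornerDist c u) a r :=
      le_ciInf (iInf_le_stepDist _ a)
    refine le_trans ?_ (Nat.succ_le_succ hle)
    unfold stepDist
    split_ifs
    · exact le_rfl
    · exact ih s

/-- The distances from the root vertex to the corners of the outer triangle. -/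
def rootDist (s : Fin 3) : ℕ := if s = 0 then 0 else 1

theorem rootDist_le_one (s : Fin 3) : rootDist s ≤ 1 := by
  unfold rootDist
  split_ifs <;> simp

theorem iInf_rootDist : ⨅ s, rootDist s = 0 :=
  Nat.le_zero.1 (ciInf_le' rootDist 0)

theorem stepDist_rootDist_one : stepDist rootDist 1 = fun _ => 1 := by
  funext s
  unfold stepDist
  rw [iInf_rootDist]
  fin_cases s <;> rfl

theorem stepDist_rootDist_of_ne_one (h : a ≠ 1) : stepDist rootDist a = rootDist := by
  funext s
  unfold stepDist
  split_ifs with ha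
  · rw [iInf_rootDist, rootDist, if_neg]
    rintro rfl
    exact h ha
  · rfl

/-- The first time at which a property holds, `⊤` if there is none. -/
noncomputable def firstTime (Q : ℕ → Prop) : ℕ∞ := sInf {i : ℕ∞ | ∃ n : ℕ, i = n ∧ Q n}

theorem firstTime_eq_top_iff {Q : ℕ → Prop} : firstTime Q = ⊤ ↔ ∀ n, ¬ Q n := by
  rw [firstTime, sInf_eq_top]
  constructor
  · exact fun h n hn => ENat.natCast_ne_top n (h _ ⟨n, rfl, hn⟩)
  · rintro h _ ⟨n, -, hn⟩
    exact absurd hn (h n)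

theorem firstTime_eq_coe_iff {Q : ℕ → Prop} : firstTime Q = T ↔ Q T ∧ ∀ n, Q n → T ≤ n := by
  constructor
  · intro h
    obtain ⟨k, hk⟩ : ∃ k, Q k := by
      by_contra! hQ
      exact ENat.natCast_ne_top T (h ▸ firstTime_eq_top_iff.2 hQ)
    obtain ⟨n, hn, hQ⟩ := csInf_mem (s := {i : ℕ∞ | ∃ n : ℕ, i = n ∧ Q n}) ⟨k, k, rfl, hk⟩
    obtain rfl : T = n := ENat.natCast_inj.1 (h.symm.trans hn)
    exact ⟨hQ, fun k hk => ENat.natCast_le_natCast.1 (h ▸ sInf_le ⟨k, rfl, hk⟩)⟩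
  · rintro ⟨hT, hmin⟩
    refine le_antisymm (sInf_le ⟨T, rfl, hT⟩) (le_sInf ?_)
    rintro _ ⟨n, rfl, hn⟩
    exact ENat.natCast_le_natCast.2 (hmin n hn)

/-- The letters of `u` numbered from `T + 1` to `n` contain each of `1`, `2`, `3`. -/
def IsBlock (u : Word) (T : ℕ∞) (n : ℕ) : Prop :=
  n ≤ u.length ∧ T < n ∧ letterIn u 1 T n ∧ letterIn u 2 T n ∧ letterIn u 3 T n

theorem isBlock_iff : IsBlock u T b ↔ b ≤ u.length ∧ ∀ s, letterIn u (letter s) T b := by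
  constructor
  · rintro ⟨h, -, h1, h2, h3⟩
    refine ⟨h, fun s => ?_⟩
    fin_cases s
    exacts [h1, h2, h3]
  · rintro ⟨h, h'⟩
    obtain ⟨r, hr, hr', -⟩ := h' 0
    exact ⟨h, hr.trans_lt (ENat.natCast_lt_natCast.2 hr'), h' 0, h' 1, h' 2⟩

theorem not_isBlock_of_length_le (h : u.length ≤ T) (n : ℕ) : ¬ IsBlock u T n := by
  rintro ⟨hn, hT, -⟩
  exact absurd (ENat.natCast_lt_natCast.1 hT) (by omega)

theorem letterIn_snoc_of_le {T : ℕ∞} (h : j ≤ u.length) :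
    letterIn (u ++ [a]) b T j ↔ letterIn u b T j := by
  refine exists_congr fun r => and_congr_right fun _ => and_congr_right fun hr => ?_
  rw [List.getElem?_append_left (by omega)]

theorem letterIn_snoc (h : T ≤ u.length) :
    letterIn (u ++ [a]) b T (u.length + 1) ↔ letterIn u b T u.length ∨ a = b := by
  constructor
  · rintro ⟨r, hr, hr', e⟩
    rcases Nat.lt_succ_iff_lt_or_eq.1 hr' with h' | rfl
    · rw [List.getElem?_append_left h'] at e
      exact .inl ⟨r, hr, h', e⟩
    · exact .inr (by simpa using e)
  · rintro (⟨r, hr, hr', e⟩ | rfl)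
    · exact ⟨r, hr, by omega, by rwa [List.getElem?_append_left hr']⟩
    · exact ⟨u.length, ENat.natCast_le_natCast.2 h, by omega, by simp⟩

theorem isBlock_snoc_of_le {n : ℕ} (h : n ≤ u.length) : IsBlock (u ++ [a]) T n ↔ IsBlock u T n := by
  simp only [isBlock_iff, letterIn_snoc_of_le h, List.length_append, List.length_singleton, h,
    Nat.le_succ_of_le h]

theorem isBlock_snoc_length (h : T ≤ u.length) : IsBlock (u ++ [a]) T (u.length + 1) ↔
    ∀ s, letterIn u (letter s) T u.length ∨ a = letter s := by
  simp [isBlock_iff, letterIn_snoc h]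

theorem tau_two (u : Word) : tau u 2 = firstTime fun n => 0 < n ∧ u[n - 1]? = some 1 := rfl

theorem tau_add_three (u : Word) (j : ℕ) :
    tau u (j + 3) = firstTime (IsBlock u (tau u (j + 2))) := rfl

theorem tau_two_eq_top_iff : tau u 2 = ⊤ ↔ 1 ∉ u := by
  rw [tau_two, firstTime_eq_top_iff, List.mem_iff_getElem?, not_exists]
  exact ⟨fun h i hi => h (i + 1) ⟨i.succ_pos, hi⟩, fun h n hn => h (n - 1) hn.2⟩

theorem tau_two_snoc_one (h : 1 ∉ u) : tau (u ++ [1]) 2 = (u.length + 1 : ℕ) := by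
  rw [tau_two, firstTime_eq_coe_iff]
  refine ⟨⟨Nat.succ_pos _, by simp⟩, fun n hn => ?_⟩
  by_contra! hlt
  rw [List.getElem?_append_left (by omega)] at hn
  exact h (List.mem_of_getElem? hn.2)

theorem tau_snoc_of_eq_coe (a : ℕ) (h : tau u j = T) (hT : T ≤ u.length) :
    tau (u ++ [a]) j = T := by
  induction j using Nat.strong_induction_on generalizing T with
  | _ j ih =>
    match j with
    | 0 => exact h
    | 1 => exact h
    | 2 =>
      rw [tau_two, firstTime_eq_coe_iff] at h ⊢
      obtain ⟨⟨hpos, hone⟩, hmin⟩ := h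
      refine ⟨⟨hpos, by rwa [List.getElem?_append_left (by omega)]⟩, fun n hn => ?_⟩
      by_contra! hlt
      rw [List.getElem?_append_left (by omega)] at hn
      exact hlt.not_ge (hmin n hn)
    | j + 3 =>
      have hne : tau u (j + 2) ≠ ⊤ := by
        intro htop
        rw [tau_add_three, firstTime_eq_coe_iff, htop] at h
        exact not_top_lt h.1.2.1
      obtain ⟨T', hT'⟩ := ENat.ne_top_iff_exists.1 hne
      rw [tau_add_three, ← hT', firstTime_eq_coe_iff] at h
      obtain ⟨hblock, hmin⟩ := h
      have hlt : T' < T := ENat.natCast_lt_natCast.1 hblock.2.1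
      rw [tau_add_three, ih (j + 2) (by omega) hT'.symm (by omega), firstTime_eq_coe_iff]
      refine ⟨(isBlock_snoc_of_le hT).2 hblock, fun n hn => ?_⟩
      by_contra! hnT
      exact hnT.not_ge (hmin n ((isBlock_snoc_of_le (by omega)).1 hn))

theorem tau_eq_top_of_le {k : ℕ} (h : tau u (j + 2) = ⊤) (hk : j + 2 ≤ k) : tau u k = ⊤ := by
  induction k, hk using Nat.le_induction with
  | base => exact h
  | succ k hk ih =>
    obtain ⟨i, rfl⟩ : ∃ i, k = i + 2 := ⟨k - 2, by omega⟩
    rw [tau_add_three, ih, firstTime_eq_top_iff]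
    exact fun n hn => not_top_lt hn.2.1

theorem passage_eq_of_tau (h : tau u (j + 1) = T) (hT : T ≤ u.length) (h' : tau u (j + 2) = ⊤) :
    passage u = j + 1 := by
  have hmax : IsGreatest {i : ℕ | 1 ≤ i ∧ tau u i ≤ u.length} (j + 1) := by
    refine ⟨⟨by omega, h.trans_le (ENat.natCast_le_natCast.2 hT)⟩, fun i hi => ?_⟩
    by_contra! hlt
    exact ENat.natCast_ne_top _ (top_le_iff.1 ((tau_eq_top_of_le h' hlt).symm.trans_le hi.2))
  exact hmax.csSup_eq

/-- After reading `u`, the last passage time is `τ_{j+1}(u) = T`, and the distances from the root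
vertex to the corners of the current triangle are as at the start before the first passage, while
later they are `j`, or `j + 1` for the corners replaced since time `T`. -/
structure PassageState (u : Word) (j T : ℕ) : Prop where
  tau_eq : tau u (j + 1) = T
  le_length : T ≤ u.length
  tau_next : tau u (j + 2) = ⊤
  cornerDist_zero : j = 0 → cornerDist rootDist u = rootDist
  cornerDist_pos : j ≠ 0 → ∀ s, (letterIn u (letter s) T u.length → cornerDist rootDist u s = j + 1)
    ∧ (¬ letterIn u (letter s) T u.length → cornerDist rootDist u s = j)

namespace PassageState

theorem iInf_cornerDist (h : PassageState u j T) : ⨅ s, cornerDist rootDist u s = j := by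
  rcases j with _ | j
  · rw [h.cornerDist_zero rfl, iInf_rootDist]
  have hcorner := h.cornerDist_pos j.succ_ne_zero
  have hblock : ¬ IsBlock u T u.length := by
    have := h.tau_next
    rw [tau_add_three, h.tau_eq, firstTime_eq_top_iff] at this
    exact this _
  obtain ⟨s, hs⟩ : ∃ s, ¬ letterIn u (letter s) T u.length := by
    by_contra! hall
    exact hblock (isBlock_iff.2 ⟨le_rfl, hall⟩)
  refine le_antisymm ((ciInf_le' _ s).trans_eq ((hcorner s).2 hs)) (le_ciInf fun r => ?_)
  by_cases hr : letterIn u (letter r) T u.length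
  · exact ((hcorner r).1 hr).ge.trans' (Nat.le_succ _)
  · exact ((hcorner r).2 hr).ge

theorem passage_eq (h : PassageState u j T) : passage u = j + 1 :=
  passage_eq_of_tau h.tau_eq h.le_length h.tau_next

theorem nil : PassageState [] 0 0 where
  tau_eq := rfl
  le_length := le_rfl
  tau_next := tau_two_eq_top_iff.2 List.not_mem_nil
  cornerDist_zero _ := rfl
  cornerDist_pos h := absurd rfl h

theorem of_tau_eq_length (h : tau u (j + 2) = u.length)
    (hc : ∀ s, cornerDist rootDist u s = j + 1) : PassageState u (j + 1) u.length where
  tau_eq := h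
  le_length := le_rfl
  tau_next := by
    rw [tau_add_three, h, firstTime_eq_top_iff]
    exact not_isBlock_of_length_le le_rfl
  cornerDist_zero h := absurd h j.succ_ne_zero
  cornerDist_pos _ s := by
    refine ⟨?_, fun _ => hc s⟩
    rintro ⟨r, hr, hr', -⟩
    exact absurd (ENat.natCast_le_natCast.1 hr) (by omega)

theorem snoc_of_ne_one (h : PassageState u 0 T) (ha : a ≠ 1) : PassageState (u ++ [a]) 0 T where
  tau_eq := tau_snoc_of_eq_coe a h.tau_eq h.le_length
  le_length := h.le_length.trans (by simp)
  tau_next := by simpa [tau_two_eq_top_iff, ha.symm] using tau_two_eq_top_iff.1 h.tau_next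
  cornerDist_zero _ := by
    rw [cornerDist_snoc, h.cornerDist_zero rfl, stepDist_rootDist_of_ne_one ha]
  cornerDist_pos h := absurd rfl h

theorem snoc_one (h : PassageState u 0 T) : PassageState (u ++ [1]) 1 (u ++ [1]).length := by
  refine of_tau_eq_length ?_ fun s => ?_
  · rw [tau_two_snoc_one (tau_two_eq_top_iff.1 h.tau_next), List.length_append,
      List.length_singleton]
  · rw [cornerDist_snoc, h.cornerDist_zero rfl, stepDist_rootDist_one]

theorem cornerDist_snoc_eq (h : PassageState u j T) (a : ℕ) (s : Fin 3) :
    cornerDist rootDist (u ++ [a]) s =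
      if a = letter s then j + 1 else cornerDist rootDist u s := by
  rw [cornerDist_snoc, stepDist, h.iInf_cornerDist]

theorem eq_length_of_isBlock_snoc (h : PassageState u (j + 1) T) {n : ℕ}
    (hn : IsBlock (u ++ [a]) T n) : n = u.length + 1 := by
  have hnext := h.tau_next
  rw [tau_add_three, h.tau_eq, firstTime_eq_top_iff] at hnext
  by_contra hne
  have hle : n ≤ u.length := by
    have := hn.1
    simp only [List.length_append, List.length_singleton] at this
    omega
  exact hnext n ((isBlock_snoc_of_le hle).1 hn)

theorem snoc_of_block (h : PassageState u (j + 1) T)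
    (ha : ∀ s, letterIn u (letter s) T u.length ∨ a = letter s) :
    PassageState (u ++ [a]) (j + 2) (u ++ [a]).length := by
  refine of_tau_eq_length ?_ fun s => ?_
  · rw [tau_add_three, tau_snoc_of_eq_coe a h.tau_eq h.le_length, firstTime_eq_coe_iff,
      List.length_append, List.length_singleton]
    exact ⟨(isBlock_snoc_length h.le_length).2 ha, fun n hn => (h.eq_length_of_isBlock_snoc hn).ge⟩
  · rw [h.cornerDist_snoc_eq]
    split_ifs with hs
    · rfl
    · exact (h.cornerDist_pos j.succ_ne_zero s).1 ((ha s).resolve_right hs)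

theorem snoc_of_not_block (h : PassageState u (j + 1) T)
    (ha : ¬ ∀ s, letterIn u (letter s) T u.length ∨ a = letter s) :
    PassageState (u ++ [a]) (j + 1) T where
  tau_eq := tau_snoc_of_eq_coe a h.tau_eq h.le_length
  le_length := h.le_length.trans (by simp)
  tau_next := by
    rw [tau_add_three, tau_snoc_of_eq_coe a h.tau_eq h.le_length, firstTime_eq_top_iff]
    intro n hn
    obtain rfl := h.eq_length_of_isBlock_snoc hn
    exact ha ((isBlock_snoc_length h.le_length).1 hn)
  cornerDist_zero h := absurd h j.succ_ne_zero
  cornerDist_pos hj s := by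
    rw [h.cornerDist_snoc_eq, List.length_append, List.length_singleton, letterIn_snoc h.le_length]
    split_ifs with hs
    · exact ⟨fun _ => rfl, fun hno => absurd (.inr hs) hno⟩
    · simpa only [hs, or_false] using h.cornerDist_pos hj s

end PassageState

theorem exists_passageState (u : Word) : ∃ j T, PassageState u j T := by
  induction u using List.reverseRecOn with
  | nil => exact ⟨0, 0, .nil⟩
  | append_singleton u a ih =>
    obtain ⟨_ | j, T, h⟩ := ih
    · by_cases ha : a = 1
      · subst ha
        exact ⟨1, _, h.snoc_one⟩
      · exact ⟨0, T, h.snoc_of_ne_one ha⟩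
    · by_cases ha : ∀ s, letterIn u (letter s) T u.length ∨ a = letter s
      · exact ⟨j + 2, _, h.snoc_of_block ha⟩
      · exact ⟨j + 1, T, h.snoc_of_not_block ha⟩

theorem passage_eq_nodeDist (u : Word) : passage u = nodeDist rootDist u := by
  obtain ⟨j, T, h⟩ := exists_passageState u
  rw [h.passage_eq, nodeDist, h.iInf_cornerDist]

theorem passage_nil : passage [] = 1 := PassageState.nil.passage_eq

theorem passage_cons (a : ℕ) (y : Word) :
    passage (a :: y) = nodeDist (stepDist rootDist a) y :=
  passage_eq_nodeDist _

theorem nodeDist_zero_le_passage_cons (a : ℕ) (y : Word) : nodeDist 0 y ≤ passage (a :: y) :=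
  (nodeDist_mono (fun _ => Nat.zero_le _) y).trans_eq (passage_cons a y).symm

theorem passage_cons_le (a : ℕ) (y : Word) : passage (a :: y) ≤ nodeDist 0 y + 1 := by
  rw [passage_cons, ← nodeDist_add_one]
  refine nodeDist_mono (fun s => ?_) y
  by_cases ha : a = 1
  · rw [ha, stepDist_rootDist_one]
    rfl
  · rw [stepDist_rootDist_of_ne_one ha]
    exact rootDist_le_one s

theorem exists_passage₂_eq (u v : Word) : ∃ w a b, u = w ++ a ∧ v = w ++ b ∧
    (∀ c ∈ a.head?, c ∉ b.head?) ∧ passage₂ u v = passage a + passage b := by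
  obtain ⟨a, b, hu, hv, hab⟩ := exists_eq_meet_append u v
  refine ⟨meet u v, a, b, hu, hv, hab, ?_⟩
  have ha := congrArg (List.drop (meet u v).length) hu
  have hb := congrArg (List.drop (meet u v).length) hv
  rw [List.drop_left] at ha hb
  rw [passage₂, ha, hb]

end

/-! ### Distances in a coded map -/

section

open RootedMap

variable {m : RootedMap} {t : Set Word} {lab : m.Dart → DartLabel} {u v w y y' : Word} {a a' : ℕ}
  {d d' : m.Dart} {s s' : Fin 3}

/-- The distance to the root vertex, as a function of the labels of the vertices. -/
noncomputable def labelRootDist : VertexLabel → ℕ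
  | .inl v => nodeDist rootDist v
  | .inr s => rootDist s

theorem labelRootDist_corner (u : Word) (s : Fin 3) :
    labelRootDist (corner u s) = cornerDist rootDist u s := by
  induction u using List.reverseRecOn with
  | nil => rfl
  | append_singleton u a ih =>
    rw [corner_snoc, cornerDist_snoc, stepDist]
    split_ifs
    · rfl
    · exact ih

theorem labelRootDist_corner_le (u : Word) (s s' : Fin 3) :
    labelRootDist (corner u s) ≤ labelRootDist (corner u s') + 1 := by
  rw [labelRootDist_corner, labelRootDist_corner]
  refine (cornerDist_le_iInf_add_one (fun s => ?_) u s).trans (Nat.succ_le_succ (ciInf_le' _ s'))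
  exact (rootDist_le_one s).trans (Nat.le_add_left _ _)

open Classical in
/-- The distance to the triangle `w` for the labels of the vertices inside this triangle, and `0`
for the other labels. -/
noncomputable def depth (w : Word) : VertexLabel → ℕ
  | .inl v => if w <+: v then nodeDist 0 (v.drop w.length) else 0
  | .inr _ => 0

theorem depth_append (w y : Word) : depth w (.inl (w ++ y)) = nodeDist 0 y := by
  rw [depth, if_pos (List.prefix_append _ _), List.drop_left]

theorem depth_of_not_prefix (h : ¬ w <+: v) : depth w (.inl v) = 0 := by
  rw [depth, if_neg h]

theorem depth_corner_self (w : Word) (s : Fin 3) : depth w (corner w s) = 0 := by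
  cases hv : corner w s with
  | inr i => rfl
  | inl v =>
    exact depth_of_not_prefix fun hp => hp.length_le.not_gt (length_lt_of_corner_eq_inl hv)

theorem depth_corner_append (w y : Word) (s : Fin 3) :
    depth w (corner (w ++ y) s) = cornerDist 0 y s := by
  induction y using List.reverseRecOn with
  | nil => rw [List.append_nil, depth_corner_self]; rfl
  | append_singleton y a ih =>
    rw [← List.append_assoc, corner_snoc, cornerDist_snoc, stepDist]
    split_ifs
    · rw [depth_append]
      rfl
    · exact ih

theorem depth_corner_of_not_prefix (h : ¬ w <+: u) (s : Fin 3) : depth w (corner u s) = 0 := by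
  cases hv : corner u s with
  | inr i => rfl
  | inl v =>
    obtain ⟨y, rfl, -⟩ := corner_eq_inl_iff.1 hv
    exact depth_of_not_prefix fun hp => h (hp.trans (List.prefix_append _ _))

theorem depth_corner_le (w u : Word) (s s' : Fin 3) :
    depth w (corner u s) ≤ depth w (corner u s') + 1 := by
  by_cases h : w <+: u
  · obtain ⟨y, rfl⟩ := h
    rw [depth_corner_append, depth_corner_append]
    exact (cornerDist_le_iInf_add_one (fun _ => Nat.zero_le _) y s).trans
      (Nat.succ_le_succ (ciInf_le' _ s'))
  · rw [depth_corner_of_not_prefix h]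
    exact Nat.zero_le _

theorem not_snoc_prefix_of_ne (h : a ≠ a') (ha : w ++ [a] <+: u) : ¬ w ++ [a'] <+: u := by
  obtain ⟨x, rfl⟩ := ha
  rintro ⟨y, hy⟩
  rw [List.append_assoc, List.append_assoc, List.append_cancel_left_eq] at hy
  exact h (List.cons.inj hy).1.symm

namespace Coding

/-- A function of the labels that varies by at most one along the sides of the triangles bounds the
distances from below. -/
theorem sub_le_dist (h : Coding m t lab) {F : VertexLabel → ℤ}
    (hF : ∀ u s s', F (corner u s) - F (corner u s') ≤ 1) (d d' : m.Dart) :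
    F (org (lab d)) - F (org (lab d')) ≤ m.dist (m.origin d) (m.origin d') := by
  choose r hr using m.origin_surjective
  have hlift : ∀ d, F (org (lab (r (m.origin d)))) = F (org (lab d)) := fun d => by
    rw [h.origin_eq_iff.1 (hr (m.origin d))]
  have := RootedMap.sub_le_dist (F := fun v => F (org (lab (r v)))) (fun d => ?_)
    (m.origin d) (m.origin d')
  · simpa only [hlift] using this
  · simp only [hlift, h.next]
    obtain ⟨_ | u, s⟩ := lab d
    · exact hF [] _ _
    · exact hF u _ _

theorem dist_le_one_of_corner (ht : IsTernaryTree t) (h : Coding m t lab) (hw : w ∈ t)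
    (hd : org (lab d) = corner w s) (hd' : org (lab d') = corner w s') :
    m.dist (m.origin d) (m.origin d') ≤ 1 := by
  obtain ⟨u, hu, hs, hs'⟩ := ht.exists_leaf_corner_eq hw s s'
  obtain ⟨x, hx⟩ := h.exists_dart (some_mem_labels (s := s).2 hu)
  obtain ⟨x', hx'⟩ := h.exists_dart (some_mem_labels (s := s').2 hu)
  rw [h.vert d x (by rw [hd, hx, ← hs]; rfl), h.vert d' x' (by rw [hd', hx', ← hs']; rfl)]
  have adjacent : s' = s ∨ s' = s + 1 ∨ s = s' + 1 := by clear * -; revert s s'; decide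
  rcases adjacent with rfl | rfl | rfl
  · rw [h.injective (hx.trans hx'.symm), dist_self]
    exact Nat.zero_le _
  · rw [h.injective (hx'.trans (by rw [h.next, hx]; rfl) : lab x' = lab (m.next x))]
    exact dist_origin_next_le_one x
  · rw [h.injective (hx.trans (by rw [h.next, hx']; rfl) : lab x = lab (m.next x')), dist_comm]
    exact dist_origin_next_le_one x'

theorem dist_le_one_of_inserted (ht : IsTernaryTree t) (h : Coding m t lab)
    (hw : w ∈ internalNodes t) (hd : org (lab d) = corner w s) (hd' : org (lab d') = .inl w) :
    m.dist (m.origin d) (m.origin d') ≤ 1 := by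
  refine h.dist_le_one_of_corner ht (ht.snoc_letter_mem hw (s + 1)) (s := s) (s' := s + 1) ?_ ?_
  · rw [hd, corner_snoc_of_ne _ (by simp)]
  · rw [hd', corner_snoc_self]

theorem exists_dist_add_le_cornerDist (ht : IsTernaryTree t) (h : Coding m t lab) (c : Fin 3 → ℕ)
    (hy : w ++ y ∈ t) (hd : org (lab d) = corner (w ++ y) s) :
    ∃ r x, org (lab x) = corner w r ∧
      m.dist (m.origin x) (m.origin d) + c r ≤ cornerDist c y s := by
  induction y using List.reverseRecOn generalizing s d with
  | nil =>
    refine ⟨s, d, by simpa using hd, ?_⟩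
    rw [dist_self, zero_add]
    exact le_rfl
  | append_singleton y a ih =>
    rw [← List.append_assoc] at hy hd
    have hwy : w ++ y ∈ t := ht.mem_of_append_mem hy
    rw [corner_snoc] at hd
    rw [cornerDist_snoc, stepDist]
    split_ifs at hd ⊢ with ha
    · obtain ⟨s₁, hs₁⟩ := exists_eq_ciInf_of_finite (f := cornerDist c y)
      obtain ⟨d₁, hd₁⟩ := h.exists_org_eq_corner ht hwy s₁
      obtain ⟨r, x, hx, hle⟩ := ih hwy hd₁
      refine ⟨r, x, hx, ?_⟩
      have hstep := h.dist_le_one_of_inserted ht (ht.mem_internalNodes_of_append_cons_mem hy) hd₁ hd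
      have htri := dist_triangle (m.origin x) (m.origin d₁) (m.origin d)
      omega
    · exact ih hwy hd

theorem exists_dist_add_le_nodeDist (ht : IsTernaryTree t) (h : Coding m t lab) (c : Fin 3 → ℕ)
    (hy : w ++ y ∈ internalNodes t) (hd : org (lab d) = .inl (w ++ y)) :
    ∃ r x, org (lab x) = corner w r ∧ m.dist (m.origin x) (m.origin d) + c r ≤ nodeDist c y := by
  have hmem := ht.snoc_letter_mem hy 0
  rw [List.append_assoc] at hmem
  obtain ⟨r, x, hx, hle⟩ := h.exists_dist_add_le_cornerDist ht c hmem (s := 0) (d := d)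
    (by rw [hd, ← List.append_assoc, corner_snoc_self])
  refine ⟨r, x, hx, hle.trans_eq ?_⟩
  rw [cornerDist_snoc, stepDist, if_pos rfl, nodeDist]

theorem org_lab_root (h : Coding m t lab) : org (lab m.root) = .inr 0 := by
  rw [← h.org_nxt_lab_inv, h.root]
  rfl

theorem dist_root (ht : IsTernaryTree t) (h : Coding m t lab) (hw : w ∈ internalNodes t)
    (hd : org (lab d) = .inl w) : m.dist m.rootVertex (m.origin d) = nodeDist rootDist w := by
  refine le_antisymm ?_ ?_
  · obtain ⟨r, x, hx, hle⟩ := h.exists_dist_add_le_nodeDist ht rootDist (w := []) hw hd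
    have hroot : m.dist m.rootVertex (m.origin x) ≤ rootDist r := by
      by_cases hr : r = 0
      · subst hr
        rw [← h.vert _ _ (h.org_lab_root.trans hx.symm)]
        exact (dist_self _).trans_le (Nat.zero_le _)
      · rw [rootDist, if_neg hr]
        exact h.dist_le_one_of_corner ht ht.root_mem (s := 0) h.org_lab_root hx
    have htri := dist_triangle m.rootVertex (m.origin x) (m.origin d)
    omega
  · have hle := h.sub_le_dist (F := fun x => (labelRootDist x : ℤ))
      (fun u s s' => by have := labelRootDist_corner_le u s s'; omega) d m.root
    rw [hd, h.org_lab_root, dist_comm] at hle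
    have hw' : labelRootDist (.inl w) = nodeDist rootDist w := rfl
    have h0 : labelRootDist (.inr 0) = 0 := rfl
    change _ ≤ m.dist (m.origin m.root) (m.origin d)
    omega

theorem nodeDist_le_dist_of_ancestor (h : Coding m t lab) (hd : org (lab d) = .inl w)
    (hd' : org (lab d') = .inl (w ++ a :: y)) :
    nodeDist 0 y ≤ m.dist (m.origin d) (m.origin d') := by
  rw [List.append_cons] at hd'
  have hle := h.sub_le_dist (F := fun x => (depth (w ++ [a]) x : ℤ))
    (fun u s s' => by have := depth_corner_le (w ++ [a]) u s s'; omega) d' d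
  rw [hd, hd', depth_append, depth_of_not_prefix fun hp => by simpa using hp.length_le,
    dist_comm] at hle
  omega

theorem dist_le_of_ancestor (ht : IsTernaryTree t) (h : Coding m t lab)
    (hy : w ++ a :: y ∈ internalNodes t) (hd : org (lab d) = .inl w)
    (hd' : org (lab d') = .inl (w ++ a :: y)) :
    m.dist (m.origin d) (m.origin d') ≤ nodeDist 0 y + 1 := by
  rw [List.append_cons] at hy hd'
  obtain ⟨r, x, hx, hle⟩ := h.exists_dist_add_le_nodeDist ht 0 hy hd'
  have hwa := ht.mem_of_append_mem hy.1
  obtain ⟨s, rfl⟩ := ht.exists_letter_eq hwa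
  have hcorner := h.dist_le_one_of_corner ht hwa (hd.trans (corner_snoc_self w s).symm) hx
  have htri := dist_triangle (m.origin d) (m.origin x) (m.origin d')
  omega

theorem nodeDist_add_le_dist_of_fork (h : Coding m t lab) (haa' : a ≠ a')
    (hd : org (lab d) = .inl (w ++ a :: y)) (hd' : org (lab d') = .inl (w ++ a' :: y')) :
    nodeDist 0 y + nodeDist 0 y' ≤ m.dist (m.origin d) (m.origin d') := by
  rw [List.append_cons] at hd hd'
  have hle := h.sub_le_dist (F := fun x => (depth (w ++ [a]) x - depth (w ++ [a']) x : ℤ))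
    (fun u s s' => ?_) d d'
  · rw [hd, hd', depth_append, depth_append,
      depth_of_not_prefix (not_snoc_prefix_of_ne haa' (List.prefix_append _ _)),
      depth_of_not_prefix (not_snoc_prefix_of_ne haa'.symm (List.prefix_append _ _))] at hle
    omega
  · have ha := depth_corner_le (w ++ [a]) u s s'
    have ha' := depth_corner_le (w ++ [a']) u s' s
    by_cases hp : w ++ [a] <+: u
    · have hzero := depth_corner_of_not_prefix (not_snoc_prefix_of_ne haa' hp)
      rw [hzero, hzero]
      omega
    · rw [depth_corner_of_not_prefix hp, depth_corner_of_not_prefix hp]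
      omega

theorem dist_le_of_fork (ht : IsTernaryTree t) (h : Coding m t lab)
    (hy : w ++ a :: y ∈ internalNodes t) (hy' : w ++ a' :: y' ∈ internalNodes t)
    (hd : org (lab d) = .inl (w ++ a :: y)) (hd' : org (lab d') = .inl (w ++ a' :: y')) :
    m.dist (m.origin d) (m.origin d') ≤ nodeDist 0 y + nodeDist 0 y' + 2 := by
  obtain ⟨x, hx⟩ := (h.mem_internalNodes_iff ht).1 (ht.mem_internalNodes_of_append_cons_mem hy.1)
  have hle := h.dist_le_of_ancestor ht hy hx hd
  have hle' := h.dist_le_of_ancestor ht hy' hx hd'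
  have htri := dist_triangle (m.origin d) (m.origin x) (m.origin d')
  rw [dist_comm] at hle
  omega

theorem abs_dist_sub_passage₂_le (ht : IsTernaryTree t) (h : Coding m t lab)
    (hu : u ∈ internalNodes t) (hv : v ∈ internalNodes t) (hd : org (lab d) = .inl u)
    (hd' : org (lab d') = .inl v) :
    |(m.dist (m.origin d) (m.origin d') : ℤ) - passage₂ u v| ≤ 4 := by
  obtain ⟨w, x, y, rfl, rfl, hne, hp⟩ := exists_passage₂_eq u v
  rw [hp, abs_le]
  rcases x with _ | ⟨a, x⟩ <;> rcases y with _ | ⟨b, y⟩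
  · rw [h.vert d d' (by rw [hd, hd']), dist_self, passage_nil]
    norm_num
  · rw [List.append_nil] at hd
    have hlow := h.nodeDist_le_dist_of_ancestor hd hd'
    have hup := h.dist_le_of_ancestor ht hv hd hd'
    have hpass := nodeDist_zero_le_passage_cons b y
    have hpass' := passage_cons_le b y
    rw [passage_nil]
    omega
  · rw [List.append_nil] at hd'
    have hlow := h.nodeDist_le_dist_of_ancestor hd' hd
    have hup := h.dist_le_of_ancestor ht hu hd' hd
    have hpass := nodeDist_zero_le_passage_cons a x
    have hpass' := passage_cons_le a x
    rw [passage_nil, dist_comm]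
    omega
  · have hab : a ≠ b := fun e => hne a rfl (congrArg some e.symm)
    have hlow := h.nodeDist_add_le_dist_of_fork hab hd hd'
    have hup := h.dist_le_of_fork ht hu hv hd hd'
    have hx := nodeDist_zero_le_passage_cons a x
    have hx' := passage_cons_le a x
    have hy := nodeDist_zero_le_passage_cons b y
    have hy' := passage_cons_le b y
    omega

end Coding

end

/-! ### Faces and internal vertices of a coded map -/

section

variable {m : RootedMap} {t : Set Word} {lab : m.Dart → DartLabel} {v : m.Vertex}

/-- `HasNodeLabel lab v w` says that `w` is the internal node coding the internal vertex `v`. -/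
def HasNodeLabel {m : RootedMap} (lab : m.Dart → DartLabel) (v : m.Vertex) (w : Word) : Prop :=
  ∀ d, m.origin d = v ↔ org (lab d) = .inl w

namespace Coding

theorem org_eq_inl_of_mem_internalVertices (h : Coding m t lab) {d : m.Dart}
    (hd : m.origin d ∈ m.internalVertices) : ∃ w, org (lab d) = .inl w := by
  cases horg : org (lab d) with
  | inl w => exact ⟨w, rfl⟩
  | inr s =>
    obtain ⟨x, hx⟩ := h.exists_dart (none_mem_labels (s := -s))
    have origin_eq : m.origin x = m.origin d := h.vert _ _ (by rw [hx, horg]; simp [org])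
    obtain ⟨u, hu⟩ := h.ne_outerFace_iff.1 (hd x origin_eq)
    simp [hx] at hu

theorem mem_internalVertices_iff (h : Coding m t lab) :
    v ∈ m.internalVertices ↔ ∃ w, HasNodeLabel lab v w := by
  obtain ⟨d, rfl⟩ := RootedMap.origin_surjective v
  constructor
  · intro hd
    obtain ⟨w, hw⟩ := h.org_eq_inl_of_mem_internalVertices hd
    exact ⟨w, fun x => by rw [h.origin_eq_iff, hw]⟩
  · rintro ⟨w, hw⟩ x hx
    have org_eq : org (lab x) = .inl w := (hw x).1 hx
    rw [h.ne_outerFace_iff]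
    generalize lab x = p at org_eq ⊢
    obtain ⟨_ | u, s⟩ := p
    · cases org_eq
    · exact ⟨u, rfl⟩

theorem exists_hasNodeLabel (ht : IsTernaryTree t) (h : Coding m t lab) {w : Word}
    (hw : w ∈ internalNodes t) : ∃ v ∈ m.internalVertices, HasNodeLabel lab v w := by
  obtain ⟨d, hd⟩ := (h.mem_internalNodes_iff ht).1 hw
  have label : HasNodeLabel lab (m.origin d) w := fun x => by rw [h.origin_eq_iff, hd]
  exact ⟨m.origin d, h.mem_internalVertices_iff.2 ⟨w, label⟩, label⟩

theorem bijOn_internalNodes (ht : IsTernaryTree t) (h : Coding m t lab) {ν : m.Vertex → Word}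
    (hν : ∀ v ∈ m.internalVertices, HasNodeLabel lab v (ν v)) :
    Set.BijOn ν m.internalVertices (internalNodes t) := by
  refine ⟨fun v hv => ?_, fun v hv v' hv' heq => ?_, fun w hw => ?_⟩
  · obtain ⟨d, rfl⟩ := RootedMap.origin_surjective v
    exact h.mem_internalNodes_of_org ht ((hν _ hv d).1 rfl)
  · obtain ⟨d, rfl⟩ := RootedMap.origin_surjective v
    exact (hν _ hv' d).2 (heq ▸ (hν _ hv d).1 rfl)
  · obtain ⟨v, hv, hvw⟩ := h.exists_hasNodeLabel ht hw
    obtain ⟨d, rfl⟩ := RootedMap.origin_surjective v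
    exact ⟨_, hv, Sum.inl_injective (((hν _ hv d).1 rfl).symm.trans ((hvw d).1 rfl))⟩

theorem bijOn_leaves (h : Coding m t lab) {ℓ : m.Face → Word}
    (hℓ : ∀ f ∈ m.finiteFaces, HasFaceLabel lab f (ℓ f)) :
    Set.BijOn ℓ m.finiteFaces (leaves t) := by
  refine ⟨fun f hf => ?_, fun f hf f' hf' heq => ?_, fun u hu => ?_⟩
  · obtain ⟨d, rfl⟩ := RootedMap.faceOf_surjective f
    exact h.mem d _ ((hℓ _ hf d).1 rfl)
  · obtain ⟨d, rfl⟩ := RootedMap.faceOf_surjective f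
    exact (hℓ _ hf' d).2 (heq ▸ (hℓ _ hf d).1 rfl)
  · obtain ⟨f, hf, hfu⟩ := h.exists_finiteFace hu
    obtain ⟨d, rfl⟩ := RootedMap.faceOf_surjective f
    exact ⟨_, hf, Option.some_injective _ (((hℓ _ hf d).1 rfl).symm.trans ((hfu d).1 rfl))⟩

theorem faceDegree_eq (h : Coding m t lab) (f : m.Face) : m.faceDegree f = 3 := by
  obtain ⟨d, rfl⟩ := RootedMap.faceOf_surjective f
  have bijective : Function.Bijective fun x : {x // m.faceOf x = m.faceOf d} => (lab x).2 := by
    constructor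
    · rintro ⟨x, hx⟩ ⟨y, hy⟩ hxy
      exact Subtype.ext (h.injective (Prod.ext (h.faceOf_eq_iff.1 (hx.trans hy.symm)) hxy))
    · intro s
      obtain ⟨x, hx⟩ := h.exists_dart (p := ((lab d).1, s)) (h.mem d)
      exact ⟨⟨x, h.faceOf_eq_iff.2 (by rw [hx])⟩, by simp only [hx]⟩
  rw [RootedMap.faceDegree, Nat.card_congr (Equiv.ofBijective _ bijective), Nat.card_fin]

theorem card_face (h : Coding m t lab) : Nat.card m.Face = (leaves t).ncard + 1 := by
  have := m.finite_dart
  have : Finite m.Face := Finite.of_surjective m.faceOf RootedMap.faceOf_surjective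
  choose! ℓ _ hℓ using fun f (hf : f ∈ m.finiteFaces) => h.exists_hasFaceLabel hf
  have finiteFaces_eq : m.finiteFaces = Set.univ \ {m.outerFace} := by
    ext f
    simp [RootedMap.finiteFaces]
  rw [← (h.bijOn_leaves hℓ).ncard_eq, finiteFaces_eq,
    Set.ncard_sdiff_singleton_add_one (Set.mem_univ _), Set.ncard_univ]

end Coding

/-! ### Counting the nodes of a ternary tree -/

variable {u : Word} {n : ℕ}

theorem mem_ternaryTrees_iff : t ∈ ternaryTrees n ↔ IsTernaryTree t ∧ t.ncard = n := by
  constructor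
  · rintro ⟨planar, childRanks_eq, hcard⟩
    refine ⟨⟨planar, childRanks_eq, Set.finite_of_encard_eq_coe hcard⟩, ?_⟩
    rw [Set.ncard, hcard, ENat.toNat_natCast]
  · rintro ⟨ht, rfl⟩
    exact ⟨ht.toIsPlanarTree, ht.childRanks_eq, ht.finite.cast_ncard_eq.symm⟩

theorem singleton_nil_mem_ternaryTrees : {[]} ∈ ternaryTrees 1 :=
  mem_ternaryTrees_iff.2 ⟨.singleton_nil, Set.ncard_singleton _⟩

namespace IsTernaryTree

theorem ncard_growTree (ht : IsTernaryTree t) (hu : u ∈ leaves t) :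
    (_root_.growTree t u).ncard = t.ncard + 3 := by
  have hcard := encard_growTree hu
  rw [← (ht.growTree hu).finite.cast_ncard_eq, ← ht.finite.cast_ncard_eq] at hcard
  exact_mod_cast hcard

theorem ncard_leaves_growTree (ht : IsTernaryTree t) (hu : u ∈ leaves t) :
    (leaves (_root_.growTree t u)).ncard = (leaves t).ncard + 2 := by
  have leaves_finite : (leaves t).Finite := ht.finite.subset fun v hv => hv.1
  have ncard_children : (Set.range fun s => u ++ [letter s]).ncard = 3 := by
    rw [← Set.image_univ, Set.ncard_image_of_injective _ fun a b h => ?_, Set.ncard_univ,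
      Nat.card_fin]
    simpa [letter, Fin.val_inj] using h
  have disjoint : Disjoint (leaves t \ {u}) (Set.range fun s => u ++ [letter s]) := by
    rw [Set.disjoint_left]
    rintro _ hv ⟨s, rfl⟩
    exact (mem_leaves_iff.1 hu).2 _ hv.1.1
  rw [ht.leaves_growTree hu, Set.ncard_union_eq disjoint leaves_finite.sdiff (Set.finite_range _),
    ncard_children, ← Set.ncard_sdiff_singleton_add_one hu leaves_finite]

theorem three_mul_ncard_leaves (ht : IsTernaryTree t) :
    3 * (leaves t).ncard = 2 * t.ncard + 1 := by
  refine ht.induction (P := fun t => 3 * (leaves t).ncard = 2 * t.ncard + 1) ?_ ?_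
  · have leaves_eq : leaves {[]} = {[]} := by
      ext v
      simp [mem_leaves_iff]
    simp [leaves_eq]
  · intro t u ht hu ih
    rw [ht.ncard_leaves_growTree hu, ht.ncard_growTree hu]
    omega

end IsTernaryTree

theorem growTree_mem_ternaryTrees (h : t ∈ ternaryTrees n) (hu : u ∈ leaves t) :
    growTree t u ∈ ternaryTrees (n + 3) := by
  obtain ⟨ht, rfl⟩ := mem_ternaryTrees_iff.1 h
  exact mem_ternaryTrees_iff.2 ⟨ht.growTree hu, ht.ncard_growTree hu⟩

end

/-! ### The tree of a map -/

section

/-- The class `c` consists of maps coded by the ternary tree `t`. -/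
def IsCodedBy (c : MapClass) (t : Set Word) : Prop :=
  ∃ (m : RootedMap) (lab : m.Dart → DartLabel),
    Quotient.mk _ m = c ∧ IsTernaryTree t ∧ Coding m t lab

/-- The tree coding a class of maps. Junk for a class that no tree codes. -/
noncomputable def treeOf (c : MapClass) : Set Word := Classical.epsilon (IsCodedBy c)

/-- The labelling of the darts of `m` that codes `m` by its tree. -/
noncomputable def labOf (m : RootedMap) : m.Dart → DartLabel :=
  Classical.epsilon (Coding m (treeOf (Quotient.mk _ m)))

/-- The internal node coding an internal vertex. -/
noncomputable def nodeOf (m : RootedMap) (v : m.Vertex) : Word :=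
  Classical.epsilon (HasNodeLabel (labOf m) v)

/-- The leaf coding a finite face. -/
noncomputable def leafOf (m : RootedMap) (f : m.Face) : Word :=
  Classical.epsilon (HasFaceLabel (labOf m) f)

/-- The leaf coding the distinguished face of a marked map. -/
noncomputable def markOf (M : MarkedClass) : Word := leafOf M.out.map M.out.face

variable {c c' : MapClass} {m : RootedMap} {t t' : Set Word} {A : MarkedMap} {M M' : MarkedClass}
  {u : Word} {k n : ℕ}

namespace IsCodedBy

theorem exists_coding (h : IsCodedBy (Quotient.mk _ m) t) :
    ∃ lab : m.Dart → DartLabel, Coding m t lab := by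
  obtain ⟨m', lab, hm, -, h⟩ := h
  obtain ⟨e, he⟩ := Quotient.exact hm
  exact ⟨_, h.congr he.symm⟩

theorem isTernaryTree (h : IsCodedBy c t) : IsTernaryTree t := by
  obtain ⟨-, -, -, ht, -⟩ := h
  exact ht

theorem tree_unique (h : IsCodedBy c t) (h' : IsCodedBy c t') : t = t' := by
  obtain ⟨m, lab, rfl, ht, hlab⟩ := h
  obtain ⟨lab', hlab'⟩ := h'.exists_coding
  exact hlab.tree_unique ht h'.isTernaryTree hlab'

theorem class_unique (h : IsCodedBy c t) (h' : IsCodedBy c' t) : c = c' := by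
  obtain ⟨m, lab, rfl, ht, hlab⟩ := h
  obtain ⟨m', lab', rfl, -, hlab'⟩ := h'
  obtain ⟨e, he, -⟩ := hlab.exists_iso ht hlab'
  exact Quotient.sound ⟨e, he⟩

theorem treeOf_eq (h : IsCodedBy c t) : treeOf c = t :=
  (Classical.epsilon_spec ⟨t, h⟩ : IsCodedBy c (treeOf c)).tree_unique h

theorem coding_labOf (h : IsCodedBy (Quotient.mk _ m) t) : Coding m t (labOf m) := by
  have := h.exists_coding
  rw [← h.treeOf_eq] at this ⊢
  exact Classical.epsilon_spec this

theorem hasNodeLabel_nodeOf (h : IsCodedBy (Quotient.mk _ m) t) {v : m.Vertex}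
    (hv : v ∈ m.internalVertices) : HasNodeLabel (labOf m) v (nodeOf m v) :=
  Classical.epsilon_spec (h.coding_labOf.mem_internalVertices_iff.1 hv)

theorem hasFaceLabel_leafOf (h : IsCodedBy (Quotient.mk _ m) t) {f : m.Face}
    (hf : f ∈ m.finiteFaces) : HasFaceLabel (labOf m) f (leafOf m f) := by
  obtain ⟨u, -, hu⟩ := h.coding_labOf.exists_hasFaceLabel hf
  exact Classical.epsilon_spec ⟨u, hu⟩

theorem bijOn_nodeOf (h : IsCodedBy (Quotient.mk _ m) t) :
    Set.BijOn (nodeOf m) m.internalVertices (internalNodes t) :=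
  h.coding_labOf.bijOn_internalNodes h.isTernaryTree fun _ => h.hasNodeLabel_nodeOf

theorem bijOn_leafOf (h : IsCodedBy (Quotient.mk _ m) t) :
    Set.BijOn (leafOf m) m.finiteFaces (leaves t) :=
  h.coding_labOf.bijOn_leaves fun _ => h.hasFaceLabel_leafOf

theorem passage_nodeOf (h : IsCodedBy (Quotient.mk _ m) t) {v : m.Vertex}
    (hv : v ∈ m.internalVertices) : passage (nodeOf m v) = m.dist m.rootVertex v := by
  have hmem := h.bijOn_nodeOf.mapsTo hv
  have label := h.hasNodeLabel_nodeOf hv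
  obtain ⟨d, rfl⟩ := RootedMap.origin_surjective v
  rw [passage_eq_nodeDist, h.coding_labOf.dist_root h.isTernaryTree hmem ((label d).1 rfl)]

theorem abs_dist_sub_passage₂_nodeOf_le (h : IsCodedBy (Quotient.mk _ m) t) {v w : m.Vertex}
    (hv : v ∈ m.internalVertices) (hw : w ∈ m.internalVertices) :
    |(m.dist v w : ℤ) - (passage₂ (nodeOf m v) (nodeOf m w) : ℤ)| ≤ 4 := by
  have hmem := h.bijOn_nodeOf.mapsTo hv
  have hmem' := h.bijOn_nodeOf.mapsTo hw
  have label := h.hasNodeLabel_nodeOf hv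
  have label' := h.hasNodeLabel_nodeOf hw
  obtain ⟨d, rfl⟩ := RootedMap.origin_surjective v
  obtain ⟨d', rfl⟩ := RootedMap.origin_surjective w
  exact h.coding_labOf.abs_dist_sub_passage₂_le h.isTernaryTree hmem hmem' ((label d).1 rfl)
    ((label' d').1 rfl)

theorem degree_eq (h : IsCodedBy (Quotient.mk _ m) t) {v : m.Vertex}
    (hv : v ∈ m.internalVertices) :
    m.degree v = 3 + (binaryForest (internalNodes t) (nodeOf m v)).ncard := by
  have label := h.hasNodeLabel_nodeOf hv
  obtain ⟨d, rfl⟩ := RootedMap.origin_surjective v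
  exact h.coding_labOf.degree_eq h.isTernaryTree ((label d).1 rfl)

theorem markOf_eq (h : IsCodedBy (Quotient.mk _ A.map) t) :
    markOf (Quotient.mk _ A) = leafOf A.map A.face := by
  set B := (Quotient.mk _ A : MarkedClass).out
  obtain ⟨e, he, hface⟩ : B ≈ A := Quotient.mk_out A
  have class_eq : (Quotient.mk _ B.map : MapClass) = Quotient.mk _ A.map := Quotient.sound ⟨e, he⟩
  have hBt : IsCodedBy (Quotient.mk _ B.map) t := class_eq ▸ h
  have lab_eq : labOf B.map = labOf A.map ∘ e :=
    hBt.coding_labOf.lab_unique h.isTernaryTree (h.coding_labOf.congr he)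
  obtain ⟨d, hd⟩ := RootedMap.faceOf_surjective B.face
  have label_B := (hBt.hasFaceLabel_leafOf B.finite_face d).1 hd
  have label_A := (h.hasFaceLabel_leafOf A.finite_face (e d)).1 ((hface d).1 hd)
  rw [lab_eq, Function.comp_apply, label_A] at label_B
  exact (Option.some_injective _ label_B).symm

theorem markOf_mem_leaves (h : IsCodedBy M.map t) : markOf M ∈ leaves t := by
  obtain ⟨A, rfl⟩ := Quotient.exists_rep M
  rw [markOf_eq h]
  exact bijOn_leafOf h |>.mapsTo A.finite_face

theorem grow (h : IsCodedBy M.map t) : IsCodedBy M.grow (growTree t (markOf M)) := by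
  have hmem := h.markOf_mem_leaves
  obtain ⟨A, rfl⟩ := Quotient.exists_rep M
  have label := hasFaceLabel_leafOf h A.finite_face
  rw [← markOf_eq h] at label
  exact ⟨A.map.insert A.face, _, rfl, h.isTernaryTree.growTree hmem,
    (coding_labOf h).insert h.isTernaryTree hmem label⟩

theorem marked_unique (h : IsCodedBy M.map t) (h' : IsCodedBy M'.map t)
    (hmark : markOf M = markOf M') : M = M' := by
  obtain ⟨A, rfl⟩ := Quotient.exists_rep M
  obtain ⟨B, rfl⟩ := Quotient.exists_rep M'
  rw [markOf_eq h, markOf_eq h'] at hmark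
  obtain ⟨e, he, lab_eq⟩ := (coding_labOf h).exists_iso h.isTernaryTree (coding_labOf h')
  refine Quotient.sound ⟨e, he, fun d => ?_⟩
  rw [hasFaceLabel_leafOf h A.finite_face, hasFaceLabel_leafOf h' B.finite_face, lab_eq, hmark]

theorem exists_marked (h : IsCodedBy c t) (hu : u ∈ leaves t) :
    ∃ M : MarkedClass, M.map = c ∧ markOf M = u := by
  obtain ⟨m, rfl⟩ := Quotient.exists_rep c
  obtain ⟨f, hf, rfl⟩ := h.bijOn_leafOf.surjOn hu
  exact ⟨Quotient.mk _ ⟨m, f, hf⟩, rfl, markOf_eq (A := ⟨m, f, hf⟩) h⟩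

theorem triangle : IsCodedBy (Quotient.mk _ RootedMap.triangle) {[]} :=
  ⟨_, _, rfl, .singleton_nil, Coding.triangle⟩

end IsCodedBy

/-! ### Stack-triangulations -/

theorem grow_mem_stackTriangulations (h : M.map ∈ stackTriangulations k) :
    M.grow ∈ stackTriangulations (k + 1) := by
  cases k with
  | zero => exact h.elim
  | succ k => exact ⟨M, h, rfl⟩

theorem exists_isCodedBy (hc : c ∈ stackTriangulations k) :
    ∃ t ∈ ternaryTrees (3 * k - 2), IsCodedBy c t := by
  induction k generalizing c with
  | zero => exact hc.elim
  | succ k ih =>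
    cases k with
    | zero =>
      obtain rfl : c = _ := hc
      exact ⟨_, singleton_nil_mem_ternaryTrees, .triangle⟩
    | succ k =>
      obtain ⟨M, hM, rfl⟩ := hc
      obtain ⟨t, ht, h⟩ := ih hM
      exact ⟨_, growTree_mem_ternaryTrees ht h.markOf_mem_leaves, h.grow⟩

theorem isCodedBy_treeOf (hc : c ∈ stackTriangulations k) : IsCodedBy c (treeOf c) := by
  obtain ⟨t, -, h⟩ := exists_isCodedBy hc
  rwa [h.treeOf_eq]

theorem treeOf_mem_ternaryTrees (hc : c ∈ stackTriangulations k) :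
    treeOf c ∈ ternaryTrees (3 * k - 2) := by
  obtain ⟨t, ht, h⟩ := exists_isCodedBy hc
  rwa [h.treeOf_eq]

theorem stackTriangulations_index_eq (hc : c ∈ stackTriangulations k)
    (ht : treeOf c ∈ ternaryTrees (3 * n - 2)) : k = n := by
  obtain ⟨ternary, hcard⟩ := mem_ternaryTrees_iff.1 (treeOf_mem_ternaryTrees hc)
  obtain ⟨-, hcard'⟩ := mem_ternaryTrees_iff.1 ht
  have : 0 < (treeOf c).ncard := (Set.ncard_pos ternary.finite).2 ⟨[], ternary.root_mem⟩
  omega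

theorem IsTernaryTree.exists_stackTriangulation (ht : IsTernaryTree t) :
    ∃ k, ∃ c ∈ stackTriangulations k, IsCodedBy c t := by
  refine ht.induction (P := fun t => ∃ k, ∃ c ∈ stackTriangulations k, IsCodedBy c t)
    ⟨1, _, rfl, .triangle⟩ ?_
  rintro t u - hu ⟨k, c, hc, h⟩
  obtain ⟨M, rfl, rfl⟩ := h.exists_marked hu
  exact ⟨k + 1, _, grow_mem_stackTriangulations hc, h.grow⟩

theorem bijOn_treeOf (k : ℕ) :
    Set.BijOn treeOf (stackTriangulations k) (ternaryTrees (3 * k - 2)) := by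
  refine ⟨fun c => treeOf_mem_ternaryTrees, fun c hc c' hc' heq => ?_, fun t ht => ?_⟩
  · exact (isCodedBy_treeOf hc).class_unique (heq ▸ isCodedBy_treeOf hc')
  · obtain ⟨n, c, hc, h⟩ := (mem_ternaryTrees_iff.1 ht).1.exists_stackTriangulation
    obtain rfl := h.treeOf_eq
    obtain rfl := stackTriangulations_index_eq hc ht
    exact ⟨c, hc, rfl⟩

theorem card_face_of_mem_stackTriangulations
    (hm : (Quotient.mk _ m : MapClass) ∈ stackTriangulations k) : Nat.card m.Face = 2 * k := by
  obtain ⟨ht, hcard⟩ := mem_ternaryTrees_iff.1 (treeOf_mem_ternaryTrees hm)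
  have leaves_card := ht.three_mul_ncard_leaves
  have : 0 < (treeOf (Quotient.mk _ m)).ncard := (Set.ncard_pos ht.finite).2 ⟨[], ht.root_mem⟩
  rw [(isCodedBy_treeOf hm).coding_labOf.card_face]
  omega

/-! ### Histories -/

/-- The tree and the leaf coding a marked map: one term of a tree history. -/
noncomputable def treeLeafOf (M : MarkedClass) : Set Word × Word := (treeOf M.map, markOf M)

variable {h h₁ h₂ : List MarkedClass} {g : List (Set Word × Word)}

theorem mem_stackTriangulations_of_isMapHistory (hh : IsMapHistory h c) :
    c ∈ stackTriangulations (h.length + 1) := by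
  induction hh with
  | nil => rfl
  | snoc h M _ ih =>
    rw [List.length_append]
    exact grow_mem_stackTriangulations ih

theorem isCodedBy_of_isMapHistory (hh : IsMapHistory h c) : IsCodedBy c (treeOf c) :=
  isCodedBy_treeOf (mem_stackTriangulations_of_isMapHistory hh)

theorem isCodedBy_of_mem_isMapHistory (hh : IsMapHistory h c) :
    ∀ M ∈ h, IsCodedBy M.map (treeOf M.map) := by
  induction hh with
  | nil => simp
  | snoc h M hM ih =>
    simp only [List.mem_append, List.mem_singleton]
    rintro N (hN | rfl)
    exacts [ih N hN, isCodedBy_of_isMapHistory hM]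

theorem isTreeHistory_map_treeLeafOf (hh : IsMapHistory h c) :
    IsTreeHistory (h.map treeLeafOf) (treeOf c) := by
  induction hh with
  | nil =>
    rw [IsCodedBy.triangle.treeOf_eq]
    exact .nil
  | snoc h M hM ih =>
    have coded := isCodedBy_of_isMapHistory hM
    rw [coded.grow.treeOf_eq, List.map_append]
    exact .snoc _ _ _ ih coded.markOf_mem_leaves

theorem exists_isMapHistory (hg : IsTreeHistory g t) :
    ∃ h c, IsMapHistory h c ∧ h.map treeLeafOf = g ∧ treeOf c = t := by
  induction hg with
  | nil => exact ⟨[], _, .nil, rfl, IsCodedBy.triangle.treeOf_eq⟩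
  | snoc g t u _ hu ih =>
    obtain ⟨h, c, hc, rfl, rfl⟩ := ih
    have coded := isCodedBy_of_isMapHistory hc
    obtain ⟨M, rfl, rfl⟩ := coded.exists_marked hu
    exact ⟨h ++ [M], _, .snoc h M hc, List.map_append, coded.grow.treeOf_eq⟩

theorem isTreeHistory_cases (hg : IsTreeHistory g t) :
    (g = [] ∧ t = {[]}) ∨ ∃ g₀ t₀ u, g = g₀ ++ [(t₀, u)] ∧ t = growTree t₀ u := by
  cases hg with
  | nil => exact .inl ⟨rfl, rfl⟩
  | snoc g t u _ _ => exact .inr ⟨g, t, u, rfl, rfl⟩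

theorem isTreeHistory_unique (hg : IsTreeHistory g t) (hg' : IsTreeHistory g t') : t = t' := by
  rcases isTreeHistory_cases hg with ⟨rfl, rfl⟩ | ⟨g₀, t₀, u, rfl, rfl⟩ <;>
    rcases isTreeHistory_cases hg' with ⟨heq, rfl⟩ | ⟨g₁, t₁, u₁, heq, rfl⟩
  · rfl
  · simp at heq
  · simp at heq
  · obtain ⟨-, heq⟩ := List.append_inj' heq rfl
    cases heq
    rfl

theorem injOn_list_map {α β : Type*} {f : α → β} {s : Set α} (hf : Set.InjOn f s) :
    Set.InjOn (List.map f) {l | ∀ a ∈ l, a ∈ s} := by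
  intro l hl
  induction l with
  | nil => simp [eq_comm]
  | cons a l ih =>
    rintro (_ | ⟨b, l'⟩) hl' heq
    · simp at heq
    · simp only [Set.mem_ofPred_eq, List.forall_mem_cons] at hl hl'
      obtain ⟨head_eq, tail_eq⟩ := List.cons.inj heq
      rw [hf hl.1 hl'.1 head_eq, ih hl.2 hl'.2 tail_eq]

theorem injOn_treeLeafOf :
    Set.InjOn treeLeafOf {M | IsCodedBy M.map (treeOf M.map)} := by
  intro M hM M' hM' heq
  obtain ⟨tree_eq, mark_eq⟩ := Prod.ext_iff.1 heq
  have hM'' : IsCodedBy M'.map (treeOf M.map) := by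
    rw [show treeOf M.map = treeOf M'.map from tree_eq]
    exact hM'
  exact IsCodedBy.marked_unique hM hM'' mark_eq

theorem bijOn_map_treeLeafOf (k : ℕ) :
    Set.BijOn (List.map treeLeafOf) (mapHistories k) (treeHistories k) := by
  refine ⟨?_, ?_, ?_⟩
  · rintro h ⟨c, hc, hh⟩
    exact ⟨_, treeOf_mem_ternaryTrees hc, isTreeHistory_map_treeLeafOf hh⟩
  · rintro h ⟨c, -, hh⟩ h' ⟨c', -, hh'⟩
    exact injOn_list_map injOn_treeLeafOf (isCodedBy_of_mem_isMapHistory hh)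
      (isCodedBy_of_mem_isMapHistory hh')
  · rintro g ⟨t, ht, hg⟩
    obtain ⟨h, c, hh, rfl, rfl⟩ := exists_isMapHistory hg
    obtain rfl := stackTriangulations_index_eq (mem_stackTriangulations_of_isMapHistory hh) ht
    exact ⟨h, ⟨c, mem_stackTriangulations_of_isMapHistory hh, hh⟩, rfl⟩

theorem getElem?_map_treeLeafOf (hh : IsMapHistory h c) {i : ℕ}
    (hA : h[i]? = some (Quotient.mk _ A)) :
    (h.map treeLeafOf)[i]? = some (treeOf (Quotient.mk _ A.map), leafOf A.map A.face) := by
  have coded := isCodedBy_of_mem_isMapHistory hh _ (List.mem_of_getElem? hA)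
  rw [List.getElem?_map, hA, Option.map_some, treeLeafOf, IsCodedBy.markOf_eq coded]
  rfl

theorem exists_isMapHistory_iff_exists_isTreeHistory (hh₁ : IsMapHistory h₁ c)
    (hh₂ : IsMapHistory h₂ c') :
    (∃ c, IsMapHistory h₁ c ∧ IsMapHistory h₂ c) ↔
      ∃ t, IsTreeHistory (h₁.map treeLeafOf) t ∧ IsTreeHistory (h₂.map treeLeafOf) t := by
  constructor
  · rintro ⟨c, hc₁, hc₂⟩
    exact ⟨_, isTreeHistory_map_treeLeafOf hc₁, isTreeHistory_map_treeLeafOf hc₂⟩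
  · rintro ⟨t, ht₁, ht₂⟩
    obtain rfl := isTreeHistory_unique (isTreeHistory_map_treeLeafOf hh₁) ht₁
    have tree_eq := isTreeHistory_unique (isTreeHistory_map_treeLeafOf hh₂) ht₂
    have class_eq := (isCodedBy_of_isMapHistory hh₁).class_unique
      (tree_eq ▸ isCodedBy_of_isMapHistory hh₂)
    exact ⟨c, hh₁, class_eq ▸ hh₂⟩

end

end StackTriangulation

open StackTriangulation in
theorem proposition1 :
    ∃ (Ψ : MapClass → Set Word) (ψ : List MarkedClass → List (Set Word × Word))
      (ν : ∀ m : RootedMap, m.Vertex → Word) (ℓ : ∀ m : RootedMap, m.Face → Word),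
      ∀ K : ℕ, 1 ≤ K →
        -- `Ψ` is a bijection from stack-triangulations to ternary trees
        Set.BijOn Ψ (stackTriangulations K) (ternaryTrees (3 * K - 2)) ∧
        (∀ m : RootedMap, (Quotient.mk _ m : MapClass) ∈ stackTriangulations K →
          -- internal vertices correspond to internal nodes
          Set.BijOn (ν m) m.internalVertices (internalNodes (Ψ (Quotient.mk _ m))) ∧
          -- finite faces, all of them triangular, correspond to leaves; there are `2 K` faces
          Set.BijOn (ℓ m) m.finiteFaces (leaves (Ψ (Quotient.mk _ m))) ∧
          (∀ f : m.Face, m.faceDegree f = 3) ∧ Nat.card m.Face = 2 * K ∧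
          -- distances to the root vertex
          (∀ u ∈ m.internalVertices, passage (ν m u) = m.dist m.rootVertex u) ∧
          -- distances between internal vertices
          (∀ u ∈ m.internalVertices, ∀ v ∈ m.internalVertices,
            |(m.dist u v : ℤ) - (passage₂ (ν m u) (ν m v) : ℤ)| ≤ 4) ∧
          -- degrees
          (∀ u ∈ m.internalVertices, m.degree u =
            3 + (binaryForest (internalNodes (Ψ (Quotient.mk _ m))) (ν m u)).ncard)) ∧
        -- `ψ` is a bijection between histories
        Set.BijOn ψ (mapHistories K) (treeHistories K) ∧
        -- a history of a map is sent to a history of the corresponding tree, step by step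
        (∀ h ∈ mapHistories K, ∀ c, IsMapHistory h c → IsTreeHistory (ψ h) (Ψ c)) ∧
        (∀ h ∈ mapHistories K, ∀ (i : ℕ) (M : MarkedMap), h[i]? = some (Quotient.mk _ M) →
          (ψ h)[i]? = some (Ψ (Quotient.mk _ M.map), ℓ M.map M.face)) ∧
        -- consistency
        (∀ h ∈ mapHistories K, ∀ j, 1 ≤ j → j ≤ K → ψ (h.take (j - 1)) = (ψ h).take (j - 1)) ∧
        -- robustness
        (∀ h₁ ∈ mapHistories K, ∀ h₂ ∈ mapHistories K,
          (∃ c, IsMapHistory h₁ c ∧ IsMapHistory h₂ c) ↔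
            ∃ t, IsTreeHistory (ψ h₁) t ∧ IsTreeHistory (ψ h₂) t) := by
  refine ⟨treeOf, List.map treeLeafOf, nodeOf, leafOf, fun K _ =>
    ⟨bijOn_treeOf K, fun m hm => ?_, bijOn_map_treeLeafOf K, ?_, ?_, ?_, ?_⟩⟩
  · have coded := isCodedBy_treeOf hm
    exact ⟨coded.bijOn_nodeOf, coded.bijOn_leafOf, coded.coding_labOf.faceDegree_eq,
      card_face_of_mem_stackTriangulations hm, fun _ => coded.passage_nodeOf,
      fun _ hu _ hv => coded.abs_dist_sub_passage₂_nodeOf_le hu hv, fun _ => coded.degree_eq⟩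
  · exact fun _ _ _ => isTreeHistory_map_treeLeafOf
  · rintro h ⟨c, -, hh⟩ i M
    exact getElem?_map_treeLeafOf hh
  · exact fun _ _ _ _ _ => List.map_take
  · rintro h₁ ⟨c₁, -, hh₁⟩ h₂ ⟨c₂, -, hh₂⟩
    exact exists_isMapHistory_iff_exists_isTreeHistory hh₁ hh₂
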